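/- Let $\mathbb F_q$ be a finite field, $A=\mathbb F_q[T]$, $K=\mathbb F_q(T)$, $K_\infty$ the completion of $K$ at $\infty=1/T$ with $|T|=q$, $\mathbb C_\infty$ the completion of an algebraic closure of $K_\infty$, and $\Omega=\mathbb C_\infty\setminus K_\infty$ the Drinfeld upper half-plane. For $f:\Omega\to\mathbb C_\infty$, $\gamma=\begin{pmatrix}a&b\\c&d\end{pmatrix}\in \mathrm{GL}_2(K_\infty)$ and $k,m\in\mathbb Z$ put $(f|_{k,m}\gamma)(z)=(\det\gamma)^m(cz+d)^{-k}f(\gamma z)$. Let $\Gamma\subset \mathrm{GL}_2(K)$ be an arithmetic subgroup of congruence type, i.e. $\Gamma$ is commensurable with $\mathrm{GL}_2(A)$ and contains $\Gamma(\mathfrak m)=\ker(\mathrm{GL}_2(A)\to \mathrm{GL}_2(A/\mathfrak m))$ for some nonzero ideal $\mathfrak m$ of $A$. Let $\mathcal O$ be the set of rigid analytic functions on $\Omega$ that are invariant under translation by some nonzero ideal of $A$. A rigid analytic function $f$ lies in $\widetilde M^{\leqslant\ell}_{k,m}(\Gamma)$ (Drinfeld quasi-modular forms of weight $k$, type $m$,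 depth at most $\ell$) if there are $f_0,\dots,f_\ell\in\mathcal O$ with $$(f|_{k,m}\gamma)(z)=\sum_{i=0}^{\ell}f_i(z)\Big(\frac{c}{cz+d}\Big)^i\qquad\text{for all }\gamma\in\Gamma,\ z\in\Omega,$$ such that for all $i$ and all $\gamma\in \mathrm{GL}_2(K)$ the function $f_i|_{k-2i,m-i}\gamma$ is bounded as $|z|_i:=\inf_{x\in K_\infty}|z-x|\to\infty$. The $f_i$ are uniquely determined by $f$, $k$ and $m$, and one puts, for $\gamma \in \mathrm{GL}_2(K_\infty)$, $$(f\|_{k,m}\gamma)(z)=\sum_{i=0}^{\ell}\Big(\frac{-c}{cz+d}\Big)^i(f_i|_{k-2i,m-i}\gamma)(z).$$ For $\eta\in \mathrm{GL}_2(K)$ the Hecke operator on $\widetilde M^{\leqslant\ell}_{k,m}(\Gamma)$ is $T_\eta f=(\det\eta)^{k-m}\sum_{\gamma}f\|_{k,m}\gamma$, where $\gamma$ runs over a (finite) set of representatives of $\Gamma\backslash\Gamma\eta\Gamma$. A $T_\eta$-eigenform of eigenvalue $\lambda$ is a nonzero quasi-modular form $f$ with $T_\eta f=\lambda f$. The hyperderivatives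 $\mathcal D_nf$ ($n\ge0$) of a rigid analytic function $f$ on $\Omega$ are defined by $f(z+\varepsilon)=\sum_{n\ge0}(\mathcal D_nf)(z)\,\varepsilon^n$ for $\varepsilon \in \mathbb C_\infty$ with $|\varepsilon|$ small. **Proposition.** Let $k,\ell\geqslant 0$ and $m$ be integers, $f\in\widetilde M^{\leqslant\ell}_{k,m}(\Gamma)$, $\eta\in \mathrm{GL}_2(K)$ and $n\geqslant 0$. Then $T_\eta f$ is rigid analytic, $\mathcal D_nf\in\widetilde M^{\leqslant\ell+n}_{k+2n,m+n}(\Gamma)$, and $$T_\eta(\mathcal D_nf)=(\det\eta)^n\,\mathcal D_n(T_\eta f).$$ In particular, if $f$ is a $T_\eta$-eigenform of eigenvalue $\lambda$ and $\mathcal D_nf\neq0$, then $\mathcal D_nf$ is a $T_\eta$-eigenform of eigenvalue $(\det\eta)^n\lambda$. -/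

import Mathlib

open scoped NNReal
open Polynomial

noncomputable section

namespace DrinfeldQM

/-! ### The fields `K = 𝔽_q(T)`, `K_∞` and `ℂ_∞`

Throughout, `F` is a finite field with `q` elements, `F[X]` is the ring `A = 𝔽_q[T]` and
`RatFunc F` is the field `K = 𝔽_q(T)`. -/

/-- The completion `K_∞` of `K` at the place `∞ = 1/T`. -/
abbrev KInf (F : Type*) [Field F] : Type _ :=
  @RatFunc.CompletionAtInfty F _ (Classical.decEq _)

lemma one_lt_card (F : Type*) [Field F] [Finite F] : (1 : ℝ≥0) < (Nat.card F : ℝ≥0) := by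
  exact_mod_cast Finite.one_lt_card

lemma val_X (F : Type*) [Field F] :
    Valued.v (algebraMap (RatFunc F) (KInf F) RatFunc.X) = WithZero.exp (1 : ℤ) := by
  classical
  rw [RatFunc.valuedCompletionAtInfty.def]
  let _ := @RatFunc.inftyValued F _ (Classical.decEq _)
  refine (Valued.extensionValuation_apply_coe (K := RatFunc F) RatFunc.X).trans ?_
  exact @RatFunc.inftyValuation.X F _ (Classical.decEq _)

/-- The value group of `K_∞` is embedded in the real numbers so that `|T| = q`. -/
instance instRankOneKInf (F : Type*) [Field F] [Finite F] :
    Valuation.RankOne (Valued.v : Valuation (KInf F) (WithZero (Multiplicative ℤ))) where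
  hom' := (WithZeroMulInt.toNNReal (one_lt_card F).ne_bot).comp
    MonoidWithZeroHom.ValueGroup₀.embedding
  strictMono' := (WithZeroMulInt.toNNReal_strictMono (one_lt_card F)).comp
    MonoidWithZeroHom.ValueGroup₀.embedding_strictMono
  exists_val_nontrivial := by
    refine ⟨algebraMap (RatFunc F) (KInf F) RatFunc.X, ?_, ?_⟩
    · rw [val_X]; exact WithZero.exp_ne_zero
    · rw [val_X]; exact (by decide : (WithZero.exp (1 : ℤ)) ≠ 1)

/-- The absolute value on `K_∞`, normalized by `|T| = q`. -/
instance instNormedKInf (F : Type*) [Field F] [Finite F] : NontriviallyNormedField (KInf F) :=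
  Valued.toNontriviallyNormedField (KInf F) (WithZero (Multiplicative ℤ))

instance instUltrametricKInf (F : Type*) [Field F] [Finite F] : IsUltrametricDist (KInf F) :=
  Valued.instIsUltrametricDist (KInf F) (WithZero (Multiplicative ℤ))

instance instCompleteKInf (F : Type*) [Field F] [Finite F] : CompleteSpace (KInf F) :=
  let _ := @RatFunc.inftyValued F _ (Classical.decEq _)
  inferInstanceAs (CompleteSpace (UniformSpace.Completion (RatFunc F)))

/-- An algebraic closure of `K_∞`. -/
abbrev KInfAlg (F : Type*) [Field F] : Type _ := AlgebraicClosure (KInf F)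

/-- The unique extension of the absolute value of `K_∞` to its algebraic closure. -/
instance instNormedKInfAlg (F : Type*) [Field F] [Finite F] :
    NontriviallyNormedField (KInfAlg F) :=
  spectralNorm.nontriviallyNormedField (KInf F) (KInfAlg F)

instance instNormedAlgebraKInfAlg (F : Type*) [Field F] [Finite F] :
    NormedAlgebra (KInf F) (KInfAlg F) :=
  spectralNorm.normedAlgebra (KInf F) (KInfAlg F)

/-- `ℂ_∞`, the completion of an algebraic closure of `K_∞`. -/
abbrev CInf (F : Type*) [Field F] [Finite F] : Type _ := UniformSpace.Completion (KInfAlg F)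

variable {F : Type*} [Field F] [Finite F]

/-! ### The Drinfeld upper half-plane -/

variable (F) in
/-- The Drinfeld upper half-plane `Ω = ℙ¹(ℂ_∞) - ℙ¹(K_∞) = ℂ_∞ - K_∞`. -/
abbrev Omega : Type _ := {z : CInf F // z ∉ Set.range (algebraMap (KInf F) (CInf F))}

/-- `|z|_i = inf {|z - x| : x ∈ K_∞}`. -/
def imagAbs (z : Omega F) : ℝ := ⨅ x : KInf F, ‖(z : CInf F) - algebraMap (KInf F) (CInf F) x‖

/-- The standard affinoid subsets `Ω_n = {z ∈ Ω : |z| ≤ q ^ n, |z|_i ≥ q ^ (-n)}`, which form an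
admissible covering of `Ω`. -/
def affinoid (F : Type*) [Field F] [Finite F] (n : ℕ) : Set (Omega F) :=
  {z | ‖(z : CInf F)‖ ≤ (Nat.card F : ℝ) ^ n ∧ ((Nat.card F : ℝ) ^ n)⁻¹ ≤ imagAbs z}

/-- Rigid analytic functions on `Ω`: on every `Ω_n`, the function is a uniform limit of rational
functions without poles in `Ω_n`. As `ℂ_∞` is algebraically closed, such a rational function is a
polynomial `P` divided by a finite product of factors `z - a` with `a ∉ Ω_n`. -/
def IsRigidAnalytic (f : Omega F → CInf F) : Prop :=
  ∀ n : ℕ, ∀ δ : ℝ, 0 < δ → ∃ (P : (CInf F)[X]) (s : Multiset (CInf F)),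
    (∀ z ∈ affinoid F n, (z : CInf F) ∉ s) ∧
    ∀ z ∈ affinoid F n,
      ‖f z - P.eval (z : CInf F) / (s.map fun a => (z : CInf F) - a).prod‖ < δ

/-- The set `𝒪` of rigid analytic functions on `Ω` that are `I`-periodic for some nonzero ideal
`I` of `A`. -/
def periodicRigid (F : Type*) [Field F] [Finite F] : Set (Omega F → CInf F) :=
  {f | IsRigidAnalytic f ∧ ∃ I : Ideal F[X], I ≠ ⊥ ∧ ∀ a ∈ I, ∀ z w : Omega F,
    (w : CInf F) = z + algebraMap (KInf F) (CInf F)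
      (algebraMap (RatFunc F) (KInf F) (algebraMap F[X] (RatFunc F) a)) → f w = f z}

/-! ### The action of `GL₂(K_∞)` -/

/-- The factor `c z + d`. -/
def denom (γ : GL (Fin 2) (KInf F)) (z : Omega F) : CInf F :=
  algebraMap (KInf F) (CInf F) (γ 1 0) * z + algebraMap (KInf F) (CInf F) (γ 1 1)

lemma linear_ne_zero {c d : KInf F} (h : c ≠ 0 ∨ d ≠ 0) (z : Omega F) :
    algebraMap (KInf F) (CInf F) c * z + algebraMap (KInf F) (CInf F) d ≠ 0 := by
  intro h0
  by_cases hc : c = 0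
  · subst hc
    simp only [map_zero, zero_mul, zero_add] at h0
    exact (h.resolve_left (by simp)) ((_root_.map_eq_zero _).1 h0)
  · refine z.2 ⟨-d / c, ?_⟩
    have hc' : algebraMap (KInf F) (CInf F) c ≠ 0 := (_root_.map_ne_zero _).2 hc
    rw [map_div₀, map_neg, div_eq_iff hc']
    linear_combination -h0

lemma det_ne_zero {F : Type*} [Field F] (γ : GL (Fin 2) (KInf F)) : γ 0 0 * γ 1 1 - γ 0 1 * γ 1 0 ≠ 0 := by
  have h := γ.det.ne_zero
  rwa [Matrix.GeneralLinearGroup.val_det_apply, Matrix.det_fin_two] at h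

lemma denom_ne_zero (γ : GL (Fin 2) (KInf F)) (z : Omega F) : denom γ z ≠ 0 := by
  refine linear_ne_zero ?_ z
  by_contra! h
  exact det_ne_zero γ (by rw [h.1, h.2]; ring)

/-- The fractional linear transformation `z ↦ (a z + b) / (c z + d)` of `Ω`. -/
def moebius (γ : GL (Fin 2) (KInf F)) (z : Omega F) : Omega F :=
  ⟨(algebraMap (KInf F) (CInf F) (γ 0 0) * z + algebraMap (KInf F) (CInf F) (γ 0 1)) /
      denom γ z, by
    rintro ⟨x, hx⟩
    rw [eq_div_iff (denom_ne_zero γ z), denom] at hx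
    refine linear_ne_zero (c := γ 0 0 - x * γ 1 0) (d := γ 0 1 - x * γ 1 1) ?_ z ?_
    · by_contra! h
      exact det_ne_zero γ (by linear_combination γ 1 1 * h.1 - γ 1 0 * h.2)
    · simp only [map_sub, map_mul]
      linear_combination -hx⟩

/-- `det γ`, as an element of `ℂ_∞`. -/
def detC (γ : GL (Fin 2) (KInf F)) : CInf F :=
  algebraMap (KInf F) (CInf F) (γ.det : KInf F)

/-- The slash operator `(f |_{k,m} γ)(z) = (det γ)^m (c z + d)^(-k) f(γ z)`. -/
def slash (k m : ℤ) (f : Omega F → CInf F) (γ : GL (Fin 2) (KInf F)) : Omega F → CInf F :=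
  fun z => detC γ ^ m * denom γ z ^ (-k) * f (moebius γ z)

/-- `c / (c z + d)`. -/
def kappa (γ : GL (Fin 2) (KInf F)) (z : Omega F) : CInf F :=
  algebraMap (KInf F) (CInf F) (γ 1 0) / denom γ z

/-- The inclusion `GL₂(K) ⊆ GL₂(K_∞)`. -/
def toInf (F : Type*) [Field F] [Finite F] : GL (Fin 2) (RatFunc F) →* GL (Fin 2) (KInf F) :=
  Matrix.GeneralLinearGroup.map (algebraMap (RatFunc F) (KInf F))

/-! ### Arithmetic subgroups of congruence type -/

/-- The subgroup `GL₂(A)` of `GL₂(K)`. -/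
def glA (F : Type*) [Field F] : Subgroup (GL (Fin 2) (RatFunc F)) :=
  (Matrix.GeneralLinearGroup.map (n := Fin 2) (algebraMap F[X] (RatFunc F))).range

/-- The principal congruence subgroup `Γ(𝔪)`, the matrices in `GL₂(A)` that are congruent to the
identity modulo `𝔪`, as a subgroup of `GL₂(K)`. -/
def principalCongruence (F : Type*) [Field F] (I : Ideal F[X]) :
    Subgroup (GL (Fin 2) (RatFunc F)) :=
  (Matrix.GeneralLinearGroup.map (n := Fin 2) (Ideal.Quotient.mk I)).ker.map
    (Matrix.GeneralLinearGroup.map (n := Fin 2) (algebraMap F[X] (RatFunc F)))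

/-- `Γ` is an arithmetic subgroup of congruence type: it is commensurable with `GL₂(A)` and
contains `Γ(𝔪)` for some nonzero ideal `𝔪`. -/
def IsArithmeticCongruence {F : Type*} [Field F] (Γ : Subgroup (GL (Fin 2) (RatFunc F))) : Prop :=
  Subgroup.Commensurable Γ (glA F) ∧
    ∃ I : Ideal F[X], I ≠ ⊥ ∧ principalCongruence F I ≤ Γ

/-! ### Quasi-modular forms -/

/-- `P = ∑ f_i X^i` is an associated polynomial of `f` for the weight `k` and the type `m`: the
coefficients lie in `𝒪` and `(f |_{k,m} γ)(z) = ∑ f_i(z) (c / (c z + d))^i` for all `γ ∈ Γ`. -/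
def IsAssocPoly (Γ : Subgroup (GL (Fin 2) (RatFunc F))) (k m : ℤ) (f : Omega F → CInf F)
    (P : (Omega F → CInf F)[X]) : Prop :=
  (∀ i, P.coeff i ∈ periodicRigid F) ∧
  ∀ γ ∈ Γ, ∀ z : Omega F, slash k m f (toInf F γ) z =
    ∑ i ∈ Finset.range (P.natDegree + 1), P.coeff i z * kappa (toInf F γ) z ^ i

/-- `g` is bounded on vertical lines: `|g(z)|` is bounded as `|z|_i → ∞`. -/
def BoundedOnVerticalLines (g : Omega F → CInf F) : Prop :=
  ∃ N B : ℝ, ∀ z : Omega F, N ≤ imagAbs z → ‖g z‖ ≤ B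

/-- `f` belongs to the space of Drinfeld quasi-modular forms of weight `k`, type `m` and depth at
most `ℓ` for `Γ`. -/
def IsQuasiModularForm (Γ : Subgroup (GL (Fin 2) (RatFunc F))) (k m : ℤ) (ℓ : ℕ)
    (f : Omega F → CInf F) : Prop :=
  IsRigidAnalytic f ∧ ∃ P : (Omega F → CInf F)[X], IsAssocPoly Γ k m f P ∧ P.natDegree ≤ ℓ ∧
    ∀ (i : ℕ) (γ : GL (Fin 2) (RatFunc F)),
      BoundedOnVerticalLines (slash (k - 2 * i) (m - i) (P.coeff i) (toInf F γ))

open Classical in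
/-- The associated polynomial `P_f` of `f` (it is unique if it exists). -/
def assocPoly (Γ : Subgroup (GL (Fin 2) (RatFunc F))) (k m : ℤ) (f : Omega F → CInf F) :
    (Omega F → CInf F)[X] :=
  if h : ∃ P, IsAssocPoly Γ k m f P then h.choose else 0

/-- The double-slash operator
`(f ||_{k,m} γ)(z) = ∑ (-c / (c z + d))^i (f_i |_{k-2i,m-i} γ)(z)`, where `P_f = ∑ f_i X^i` is the
associated polynomial of `f` with respect to `Γ`. -/
def doubleSlash (Γ : Subgroup (GL (Fin 2) (RatFunc F))) (k m : ℤ) (f : Omega F → CInf F)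
    (γ : GL (Fin 2) (KInf F)) : Omega F → CInf F :=
  fun z => ∑ i ∈ Finset.range ((assocPoly Γ k m f).natDegree + 1),
    (-kappa γ z) ^ i * slash (k - 2 * i) (m - i) ((assocPoly Γ k m f).coeff i) γ z

/-! ### Hecke operators and hyperderivatives -/

/-- `R` is a set of representatives for the orbit space `Γ \ ΓηΓ`. -/
def IsOrbitRepresentatives {G : Type*} [Group G] (Γ : Subgroup G) (η : G) (R : Set G) : Prop :=
  R ⊆ DoubleCoset.doubleCoset η (Γ : Set G) (Γ : Set G) ∧
    ∀ g ∈ DoubleCoset.doubleCoset η (Γ : Set G) (Γ : Set G),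
      ∃! r, r ∈ R ∧ ∃ δ ∈ Γ, g = δ * r

/-- The Hecke operator `T_η f = (det η)^(k-m) ∑_{γ ∈ R} f ||_{k,m} γ` on quasi-modular forms of
weight `k` and type `m` for `Γ`, where `R` is a (necessarily finite) set of representatives for
`Γ \ ΓηΓ`. -/
def heckeOp (Γ : Subgroup (GL (Fin 2) (RatFunc F))) (η : GL (Fin 2) (RatFunc F))
    (R : Set (GL (Fin 2) (RatFunc F))) (k m : ℤ) (f : Omega F → CInf F) : Omega F → CInf F :=
  detC (toInf F η) ^ (k - m) • ∑ᶠ γ ∈ R, doubleSlash Γ k m f (toInf F γ)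

/-- `f` is a `T_η`-eigenform of eigenvalue `lam`: a nonzero quasi-modular form of weight `k` and
type `m` (and some depth) for `Γ` with `T_η f = lam f`. -/
def IsEigenform (Γ : Subgroup (GL (Fin 2) (RatFunc F))) (η : GL (Fin 2) (RatFunc F))
    (R : Set (GL (Fin 2) (RatFunc F))) (k m : ℤ) (lam : CInf F) (f : Omega F → CInf F) : Prop :=
  (∃ ℓ : ℕ, IsQuasiModularForm Γ k m ℓ f) ∧ f ≠ 0 ∧ heckeOp Γ η R k m f = lam • f

/-- `f(z + ε) = ∑ a_n ε^n` for all small `ε`. -/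
def HasTaylorCoeffs (f : Omega F → CInf F) (z : Omega F) (a : ℕ → CInf F) : Prop :=
  ∃ r : ℝ, 0 < r ∧ ∀ w : Omega F, ‖(w : CInf F) - z‖ < r →
    HasSum (fun n => a n * ((w : CInf F) - z) ^ n) (f w)

open Classical in
/-- The hyperderivative `𝒟_n f`: `(𝒟_n f)(z)` is the coefficient of `ε^n` in the expansion of
`f(z + ε)` at `ε = 0`, which exists and is unique if `f` is rigid analytic. -/
def hyperDeriv (n : ℕ) (f : Omega F → CInf F) : Omega F → CInf F :=
  fun z => if h : ∃ a, HasTaylorCoeffs f z a then h.choose n else 0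

end DrinfeldQM

end

open DrinfeldQM

/-!
Everything rests on the Cauchy estimate for power series over `ℂ_∞`: if `∑ aₙ εⁿ` is bounded by `B`
on the disc of radius `r`, then `|aₙ| rⁿ ≤ B`. As `ℂ_∞` contains roots of unity of arbitrarily large
order prime to `p`, averaging over them isolates each coefficient. The estimate shows that uniform
limits of convergent series are convergent series, so a rigid analytic function has a Taylor
expansion on every disc of radius `< |z|_i` around `z`, and that its hyperderivatives are again
rigid analytic, and bounded on vertical lines if the function is.

Write `κ = c / (c z + d)`. The Möbius action in terms of displacements is
`γ(z + ε) - γ z = det γ / (c z + d)² · v` with `v = ε / (1 + κ ε)`, and `c (z + ε) + d` is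
`(c z + d) (1 + κ ε)`. Hence `(f |_{k,m} γ)(z + ε)` is `(1 + κ ε)^(-k)` times a power series in `v`
with the coefficients `(𝒟ₙ f) |_{k+2n,m+n} γ`. Going from `ε` to `v` in `f |_{k,m} γ = ∑ f_i κ^i`
gives the associated polynomial of `𝒟ₙ f`; going from `v` to `ε` in the terms
`(-κ)^i (f_i |_{k-2i,m-i} γ)` gives `𝒟ₙ (f ‖_{k,m} γ)`. The same binomial coefficients occur in both
places, so `(𝒟ₙ f) ‖_{k+2n,m+n} γ = 𝒟ₙ (f ‖_{k,m} γ)`, and the factors of `det η` come from the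
normalization of `T_η`. The sum defining `T_η` is finite because `η` commensurates `GL₂(A)`, and
associated polynomials are unique because `κ` takes infinitely many values on `Γ`.
-/

noncomputable section

namespace DrinfeldQM

/-! ### Power series over non-archimedean fields -/

section NonarchimedeanPowerSeries

open Filter Topology Finset
open scoped PowerSeries ZeroAtInfty

variable {L : Type*} [NormedField L]

lemma sum_inv_pow_mul_sum_eq_mul {K : Type*} [Field K] {ζ : K} {N : ℕ} (hζ : IsPrimitiveRoot ζ N)
    (x : ℕ → K) {n : ℕ} (hn : n < N) :
    ∑ i ∈ range N, (ζ ^ n)⁻¹ ^ i * ∑ j ∈ range N, x j * (ζ ^ i) ^ j = N * x n := by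
  have hζ0 : ζ ≠ 0 := hζ.ne_zero (by lia)
  have orthogonality : ∀ j ∈ range N,
      ∑ i ∈ range N, (ζ ^ j / ζ ^ n) ^ i = if j = n then (N : K) else 0 := fun j hj => by
    split_ifs with hjn
    · simp [hjn, hζ0]
    · have hne : ζ ^ j / ζ ^ n ≠ 1 := fun h =>
        hjn (hζ.pow_inj (mem_range.1 hj) hn ((div_eq_one_iff_eq (pow_ne_zero n hζ0)).1 h))
      have hpow : (ζ ^ j / ζ ^ n) ^ N = 1 := by
        rw [div_pow, ← pow_mul, ← pow_mul, mul_comm j, mul_comm n, pow_mul, pow_mul,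
          hζ.pow_eq_one, one_pow, one_pow, div_one]
      rw [geom_sum_eq hne, hpow, sub_self, zero_div]
  calc ∑ i ∈ range N, (ζ ^ n)⁻¹ ^ i * ∑ j ∈ range N, x j * (ζ ^ i) ^ j
      = ∑ j ∈ range N, ∑ i ∈ range N, x j * (ζ ^ j / ζ ^ n) ^ i := by
        simp_rw [mul_sum]
        rw [sum_comm]
        refine sum_congr rfl fun j _ => sum_congr rfl fun i _ => ?_
        rw [div_eq_mul_inv, mul_pow, ← pow_mul ζ i j, mul_comm i j, pow_mul]
        ring
    _ = ∑ j ∈ range N, x j * if j = n then (N : K) else 0 :=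
        sum_congr rfl fun j hj => by rw [← mul_sum, orthogonality j hj]
    _ = N * x n := by
        simp only [mul_ite, mul_zero, sum_ite_eq', mem_range, hn, if_true, mul_comm]

/-- The field contains primitive roots of unity of arbitrarily large order prime to the residue
characteristic. They are what the Cauchy estimate for power series needs, in place of a maximum
principle. -/
class HasLargeRootsOfUnity (L : Type*) [NormedField L] : Prop where
  exists_isPrimitiveRoot :
    ∀ N₀ : ℕ, ∃ N ≥ N₀, ‖(N : L)‖ = 1 ∧ ∃ ζ : L, IsPrimitiveRoot ζ N

/-- The power series `p` converges to `g` on the closed disc of radius `‖c‖`. The radius is given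
through an element of the field, so that the disc is the image of the closed unit disc under
`ε ↦ c ε`. -/
def HasExpansion (c : L) (g : L → L) (p : L⟦X⟧) : Prop :=
  ∀ ε, ‖ε‖ ≤ ‖c‖ → HasSum (fun n => PowerSeries.coeff n p * ε ^ n) (g ε)

lemma hasSum_sum_antidiagonal {α : Type*} [AddCommMonoid α] [TopologicalSpace α] [ContinuousAdd α]
    [RegularSpace α] {f : ℕ × ℕ → α} {s : α} (hf : HasSum f s) :
    HasSum (fun n => ∑ p ∈ antidiagonal n, f p) s := by
  have h := ((HasAntidiagonal.sigmaAntidiagonalEquivProd (A := ℕ)).hasSum_iff.2 hf).sigma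
    fun n => hasSum_fintype _
  simpa only [Function.comp_apply, HasAntidiagonal.sigmaAntidiagonalEquivProd_apply,
    sum_coe_sort (antidiagonal _) f] using h

instance nonarchimedeanRing_of_isUltrametricDist [IsUltrametricDist L] : NonarchimedeanRing L where
  is_nonarchimedean := NonarchimedeanAddGroup.is_nonarchimedean

lemma summable_of_norm_le [IsUltrametricDist L] [CompleteSpace L] {ι : Type*} {f g : ι → L}
    (hg : Summable g) (hfg : ∀ i, ‖f i‖ ≤ ‖g i‖) : Summable f :=
  NonarchimedeanAddGroup.summable_of_tendsto_cofinite_zero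
    (squeeze_zero_norm hfg (by simpa using hg.tendsto_cofinite_zero.norm))

lemma norm_zsmul_le [IsUltrametricDist L] (n : ℤ) (x : L) : ‖n • x‖ ≤ ‖x‖ := by
  rw [zsmul_eq_mul, norm_mul]
  exact mul_le_of_le_one_left (norm_nonneg x) (IsUltrametricDist.norm_intCast_le_one L n)

lemma norm_one_add_eq_one [IsUltrametricDist L] {y : L} (hy : ‖y‖ < 1) : ‖1 + y‖ = 1 := by
  rw [IsUltrametricDist.norm_add_eq_max_of_norm_ne_norm] <;> simp [hy.le, hy.ne']

lemma norm_le_of_norm_sum_le [IsUltrametricDist L] {ζ : L} {N : ℕ} (hN : ‖(N : L)‖ = 1)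
    (hζ : IsPrimitiveRoot ζ N) (x : ℕ → L) {B : ℝ} (hB : 0 ≤ B)
    (h : ∀ i, ‖∑ j ∈ range N, x j * (ζ ^ i) ^ j‖ ≤ B) {n : ℕ} (hn : n < N) : ‖x n‖ ≤ B := by
  have hζ1 : ‖ζ‖ = 1 := hζ.isOfFinOrder (by lia) |>.norm_eq_one
  calc ‖x n‖ = ‖∑ i ∈ range N, (ζ ^ n)⁻¹ ^ i * ∑ j ∈ range N, x j * (ζ ^ i) ^ j‖ := by
        rw [sum_inv_pow_mul_sum_eq_mul hζ x hn, norm_mul, hN, one_mul]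
    _ ≤ B := IsUltrametricDist.norm_sum_le_of_forall_le_of_nonneg hB fun i _ => by
        simpa only [norm_mul, norm_pow, norm_inv, hζ1, one_pow, inv_one, one_mul] using h i

namespace HasExpansion

variable {c c' : L} {g g' : L → L} {p p' : L⟦X⟧}

lemma mono (h : HasExpansion c g p) (hc : ‖c'‖ ≤ ‖c‖) : HasExpansion c' g p :=
  fun ε hε => h ε (hε.trans hc)

lemma congr (h : HasExpansion c g p) (hg : ∀ ε, ‖ε‖ ≤ ‖c‖ → g ε = g' ε) : HasExpansion c g' p :=
  fun ε hε => hg ε hε ▸ h ε hε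

lemma add (h : HasExpansion c g p) (h' : HasExpansion c g' p') :
    HasExpansion c (g + g') (p + p') := fun ε hε => by
  simpa only [map_add, add_mul, Pi.add_apply] using (h ε hε).add (h' ε hε)

lemma sub (h : HasExpansion c g p) (h' : HasExpansion c g' p') :
    HasExpansion c (g - g') (p - p') := fun ε hε => by
  simpa only [map_sub, sub_mul, Pi.sub_apply] using (h ε hε).sub (h' ε hε)

lemma sum {ι : Type*} {s : Finset ι} {G : ι → L → L} {P : ι → L⟦X⟧}
    (h : ∀ i ∈ s, HasExpansion c (G i) (P i)) :
    HasExpansion c (∑ i ∈ s, G i) (∑ i ∈ s, P i) := fun ε hε => by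
  simpa only [map_sum, sum_mul, Finset.sum_apply] using hasSum_sum fun i hi => h i hi ε hε

lemma const (c b : L) : HasExpansion c (fun _ => b) (PowerSeries.C b) := fun ε _ => by
  simpa using hasSum_single (f := fun n => PowerSeries.coeff n (PowerSeries.C b) * ε ^ n) 0
    fun n hn => by simp [PowerSeries.coeff_C, hn]

protected lemma id (c : L) : HasExpansion c (fun ε => ε) PowerSeries.X := fun ε _ => by
  simpa using hasSum_single (f := fun n => PowerSeries.coeff n (PowerSeries.X : L⟦X⟧) * ε ^ n) 1
    fun n hn => by simp [PowerSeries.coeff_X, hn]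

lemma const_mul (h : HasExpansion c g p) (b : L) : HasExpansion c (fun ε => b * g ε) (b • p) :=
  fun ε hε => by simpa [mul_assoc] using (h ε hε).mul_left b

lemma rescale (h : HasExpansion c g p) {b : L} (hb : ‖b * c'‖ ≤ ‖c‖) :
    HasExpansion c' (fun ε => g (b * ε)) (PowerSeries.rescale b p) := fun ε hε => by
  have hbε : ‖b * ε‖ ≤ ‖c‖ := le_trans (by rw [norm_mul, norm_mul]; gcongr) hb
  simpa [PowerSeries.coeff_rescale, mul_pow, mul_left_comm, mul_assoc] using h (b * ε) hbε

lemma tendsto_coeff_mul_pow (h : HasExpansion c g p) :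
    Tendsto (fun n => PowerSeries.coeff n p * c ^ n) atTop (𝓝 0) :=
  (h c le_rfl).summable.tendsto_atTop_zero

/-- The null sequence of the coefficients of a convergent power series in the variable `ε / c`. -/
def nullCoeff (h : HasExpansion c g p) : C₀(ℕ, L) where
  toFun n := PowerSeries.coeff n p * c ^ n
  zero_at_infty' := by simpa [Nat.cofinite_eq_atTop] using h.tendsto_coeff_mul_pow

variable [IsUltrametricDist L]

lemma mul (h : HasExpansion c g p) (h' : HasExpansion c g' p') :
    HasExpansion c (g * g') (p * p') := fun ε hε => by
  refine (hasSum_sum_antidiagonal ((h ε hε).mul_of_nonarchimedean (h' ε hε))).congr_fun ?_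
  intro n
  rw [PowerSeries.coeff_mul, sum_mul]
  refine sum_congr rfl fun q hq => ?_
  rw [← mem_antidiagonal.1 hq, pow_add]
  ring

/-- Testing the series on `c ζ ^ i`, for `ζ` a root of unity of order larger than the index of all
non-negligible terms, separates the coefficients. -/
lemma norm_coeff_mul_pow_le [HasLargeRootsOfUnity L] (h : HasExpansion c g p) {B : ℝ}
    (hB : ∀ ε, ‖ε‖ ≤ ‖c‖ → ‖g ε‖ ≤ B) (n : ℕ) : ‖PowerSeries.coeff n p * c ^ n‖ ≤ B := by
  have hB0 : 0 ≤ B := (norm_nonneg _).trans (hB c le_rfl)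
  refine le_of_forall_pos_le_add fun δ hδ => ?_
  obtain ⟨M, hM⟩ := (h.tendsto_coeff_mul_pow.norm.eventually_le_const
    (by simpa using hδ)).exists_forall_of_atTop
  obtain ⟨N, hN, hN1, ζ, hζ⟩ := HasLargeRootsOfUnity.exists_isPrimitiveRoot (L := L) (max M (n + 1))
  have hζ1 : ‖ζ‖ = 1 := (hζ.isOfFinOrder (by lia)).norm_eq_one
  refine norm_le_of_norm_sum_le hN1 hζ (fun j => PowerSeries.coeff j p * c ^ j) (by positivity)
    (fun i => ?_) (by lia)
  have hci : ‖c * ζ ^ i‖ ≤ ‖c‖ := by simp [hζ1]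
  have norm_tail_le : ‖g (c * ζ ^ i) -
      ∑ j ∈ range N, PowerSeries.coeff j p * (c * ζ ^ i) ^ j‖ ≤ δ := by
    rw [← ((hasSum_nat_add_iff' N).2 (h _ hci)).tsum_eq]
    refine IsUltrametricDist.norm_tsum_le_of_forall_le_of_nonneg hδ.le fun j => ?_
    simpa [hζ1] using hM (j + N) (by lia)
  calc ‖∑ j ∈ range N, PowerSeries.coeff j p * c ^ j * (ζ ^ i) ^ j‖
      = ‖g (c * ζ ^ i) - (g (c * ζ ^ i) -
          ∑ j ∈ range N, PowerSeries.coeff j p * (c * ζ ^ i) ^ j)‖ := by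
        rw [sub_sub_cancel]; simp only [mul_pow, mul_assoc]
    _ ≤ B + δ := (norm_sub_le _ _).trans (add_le_add (hB _ hci) norm_tail_le)

lemma unique [HasLargeRootsOfUnity L] (hc : c ≠ 0) (h : HasExpansion c g p)
    (h' : HasExpansion c g p') : p = p' := by
  ext n
  have hn := (h.sub h').norm_coeff_mul_pow_le (B := 0) (by simp) n
  rw [norm_le_zero_iff, mul_eq_zero, or_iff_left (pow_ne_zero n hc), map_sub] at hn
  exact sub_eq_zero.1 hn

lemma dist_nullCoeff_le [HasLargeRootsOfUnity L] (h : HasExpansion c g p)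
    (h' : HasExpansion c g' p') {B : ℝ} (hB : ∀ ε, ‖ε‖ ≤ ‖c‖ → ‖g ε - g' ε‖ ≤ B) :
    dist h.nullCoeff h'.nullCoeff ≤ B :=
  (BoundedContinuousFunction.dist_le ((norm_nonneg _).trans (hB c le_rfl))).2 fun n => by
    simpa [nullCoeff, dist_eq_norm, sub_mul] using (h.sub h').norm_coeff_mul_pow_le hB n

lemma norm_sub_le_dist_nullCoeff (h : HasExpansion c g p) (h' : HasExpansion c g' p') {ε : L}
    (hε : ‖ε‖ ≤ ‖c‖) : ‖g ε - g' ε‖ ≤ dist h.nullCoeff h'.nullCoeff := by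
  rw [← ((h ε hε).sub (h' ε hε)).tsum_eq]
  refine IsUltrametricDist.norm_tsum_le_of_forall_le_of_nonneg dist_nonneg fun n => ?_
  calc ‖PowerSeries.coeff n p * ε ^ n - PowerSeries.coeff n p' * ε ^ n‖
      = ‖PowerSeries.coeff n p - PowerSeries.coeff n p'‖ * ‖ε‖ ^ n := by
        rw [← sub_mul, norm_mul, norm_pow]
    _ ≤ ‖PowerSeries.coeff n p - PowerSeries.coeff n p'‖ * ‖c‖ ^ n := by gcongr
    _ = dist (h.nullCoeff n) (h'.nullCoeff n) := by
        rw [← norm_pow, ← norm_mul, sub_mul, dist_eq_norm]; rfl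
    _ ≤ dist h.nullCoeff h'.nullCoeff :=
        BoundedContinuousFunction.dist_coe_le_dist (f := h.nullCoeff.toBCF)
          (g := h'.nullCoeff.toBCF) n

variable [CompleteSpace L]

lemma exists_nullCoeff_eq (hc : c ≠ 0) (b : C₀(ℕ, L)) :
    ∃ (g : L → L) (p : L⟦X⟧) (h : HasExpansion c g p), h.nullCoeff = b := by
  let p : L⟦X⟧ := PowerSeries.mk fun n => b n / c ^ n
  have coeff_p (n : ℕ) : PowerSeries.coeff n p * c ^ n = b n := by
    rw [PowerSeries.coeff_mk, div_mul_cancel₀ _ (pow_ne_zero n hc)]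
  refine ⟨fun ε => ∑' n, PowerSeries.coeff n p * ε ^ n, p, fun ε hε => Summable.hasSum ?_,
    ZeroAtInftyContinuousMap.ext coeff_p⟩
  refine NonarchimedeanAddGroup.summable_of_tendsto_cofinite_zero (squeeze_zero_norm
    (a := fun n => ‖b n‖) (fun n => ?_) (by
      simpa [Nat.cofinite_eq_atTop] using (zero_at_infty b).norm))
  rw [← coeff_p, norm_mul, norm_mul, norm_pow, norm_pow]
  gcongr

lemma exists_of_forall_norm_sub_le [HasLargeRootsOfUnity L] (hc : c ≠ 0)
    (h : ∀ δ > 0, ∃ g' p', HasExpansion c g' p' ∧ ∀ ε, ‖ε‖ ≤ ‖c‖ → ‖g ε - g' ε‖ ≤ δ) :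
    ∃ p, HasExpansion c g p := by
  obtain ⟨u, hu_anti, hu0, hu⟩ := exists_seq_strictAnti_tendsto (0 : ℝ)
  choose G P hGP hG using fun k => h (u k) (hu0 k)
  have dist_le (k l : ℕ) : dist (hGP k).nullCoeff (hGP l).nullCoeff ≤ u k + u l :=
    dist_nullCoeff_le _ _ fun ε hε => by
      calc ‖G k ε - G l ε‖ = ‖(g ε - G l ε) - (g ε - G k ε)‖ := by congr 1; ring
        _ ≤ u l + u k := (norm_sub_le _ _).trans (add_le_add (hG l ε hε) (hG k ε hε))
        _ = u k + u l := add_comm _ _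
  have cauchy : CauchySeq fun k => (hGP k).nullCoeff :=
    cauchySeq_of_le_tendsto_0 (fun N => u N + u N)
      (fun k l N hk hl => (dist_le k l).trans
        (add_le_add (hu_anti.antitone hk) (hu_anti.antitone hl)))
      (by simpa using hu.add hu)
  obtain ⟨b, hb⟩ := cauchySeq_tendsto_of_complete cauchy
  obtain ⟨g₀, p, h₀, rfl⟩ := exists_nullCoeff_eq hc b
  refine ⟨p, h₀.congr fun ε hε => ?_⟩
  have tendsto_g₀ : Tendsto (fun k => G k ε) atTop (𝓝 (g₀ ε)) :=
    tendsto_iff_norm_sub_tendsto_zero.2 (squeeze_zero (fun _ => norm_nonneg _)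
      (fun k => norm_sub_le_dist_nullCoeff (hGP k) h₀ hε) (tendsto_iff_dist_tendsto_zero.1 hb))
  have tendsto_g : Tendsto (fun k => G k ε) atTop (𝓝 (g ε)) :=
    tendsto_iff_norm_sub_tendsto_zero.2 (squeeze_zero (fun _ => norm_nonneg _)
      (fun k => norm_sub_rev (G k ε) (g ε) ▸ hG k ε hε) hu)
  exact tendsto_nhds_unique tendsto_g₀ tendsto_g

lemma one_add_zpow (hc : ‖c‖ < 1) (x : ℤ) :
    HasExpansion c (fun ε => (1 + ε) ^ x) (PowerSeries.binomialSeries L x) := by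
  have summable (x : ℤ) (ε : L) (hε : ‖ε‖ ≤ ‖c‖) :
      Summable fun n => PowerSeries.coeff n (PowerSeries.binomialSeries L x) * ε ^ n :=
    summable_of_norm_le (summable_geometric_of_norm_lt_one (hε.trans_lt hc)) fun n => by
      simpa using norm_zsmul_le (Ring.choose x n) (ε ^ n)
  let B (x : ℤ) (ε : L) := ∑' n, PowerSeries.coeff n (PowerSeries.binomialSeries L x) * ε ^ n
  have hB (x : ℤ) : HasExpansion c (B x) (PowerSeries.binomialSeries L x) :=
    fun ε hε => (summable x ε hε).hasSum
  have B_one (ε : L) (hε : ‖ε‖ ≤ ‖c‖) : B 1 ε = 1 + ε := by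
    refine (hB 1 ε hε).unique ?_
    have one_add_X : PowerSeries.binomialSeries L (1 : ℤ) = PowerSeries.C 1 + PowerSeries.X := by
      simpa using PowerSeries.binomialSeries_nat (R := ℤ) (A := L) 1
    rw [one_add_X]
    exact (const c 1).add (HasExpansion.id c) ε hε
  have B_add_one (x : ℤ) (ε : L) (hε : ‖ε‖ ≤ ‖c‖) : B (x + 1) ε = B x ε * (1 + ε) := by
    rw [← B_one ε hε]
    refine (hB _ ε hε).unique ?_
    rw [PowerSeries.binomialSeries_add]
    exact (hB x).mul (hB 1) ε hε
  refine (hB x).congr fun ε hε => ?_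
  have ne_zero : 1 + ε ≠ 0 := norm_ne_zero_iff.1 (by simp [norm_one_add_eq_one (hε.trans_lt hc)])
  induction x using Int.induction_on with
  | zero => simpa using (hB 0 ε hε).unique (by simpa using const c 1 ε hε)
  | succ n ih => rw [B_add_one _ ε hε, ih, zpow_add_one₀ ne_zero]
  | pred n ih =>
    have := B_add_one (-n - 1) ε hε
    rw [sub_add_cancel, ih] at this
    rw [zpow_sub_one₀ ne_zero, this, mul_inv_cancel_right₀ ne_zero]

/-- The substitution `v ↦ v / (1 + b v)`, with a factor of automorphy of weight `-x`: term by term,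
`(1 + b v) ^ x * (v / (1 + b v)) ^ r = (1 + b v) ^ (x - r) * v ^ r`. -/
lemma subst (h : HasExpansion c g p) {b : L} (hb : ‖b * c‖ < 1) (x : ℤ) :
    HasExpansion c (fun v => (1 + b * v) ^ x * g (v / (1 + b * v)))
      (PowerSeries.mk fun n => ∑ q ∈ antidiagonal n,
        Ring.choose (x - q.1) q.2 • (b ^ q.2 * PowerSeries.coeff q.1 p)) := by
  intro v hv
  have hbv : ‖b * v‖ < 1 := lt_of_le_of_lt (by rw [norm_mul, norm_mul]; gcongr) hb
  have hden : ‖1 + b * v‖ = 1 := norm_one_add_eq_one hbv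
  have hden0 : 1 + b * v ≠ 0 := norm_ne_zero_iff.1 (by simp [hden])
  let f (q : ℕ × ℕ) : L :=
    PowerSeries.coeff q.1 p * v ^ q.1 * Ring.choose (x - q.1) q.2 • (b * v) ^ q.2
  have hf : Summable f := by
    refine summable_of_norm_le ((h v hv).mul_of_nonarchimedean
      (hasSum_geometric_of_norm_lt_one hbv)).summable fun q => ?_
    simp only [f, norm_mul _ (_ • _), norm_mul _ (_ ^ q.2)]
    gcongr
    exact norm_zsmul_le _ _
  have rows (r : ℕ) : HasSum (fun s => f (r, s))
      ((1 + b * v) ^ x * (PowerSeries.coeff r p * (v / (1 + b * v)) ^ r)) := by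
    have row_value : (1 + b * v) ^ x * (PowerSeries.coeff r p * (v / (1 + b * v)) ^ r) =
        PowerSeries.coeff r p * v ^ r * (1 + b * v) ^ (x - r) := by
      rw [zpow_sub₀ hden0, zpow_natCast, div_pow]; ring
    rw [row_value]
    exact ((one_add_zpow hbv (x - r) (b * v) le_rfl).mul_left _).congr_fun fun s => by simp [f]
  have total : HasSum f ((1 + b * v) ^ x * g (v / (1 + b * v))) := by
    have := (h (v / (1 + b * v)) (by rwa [norm_div, hden, div_one])).mul_left ((1 + b * v) ^ x)
    rw [← (hf.hasSum.prod_fiberwise rows).unique this]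
    exact hf.hasSum
  refine (hasSum_sum_antidiagonal total).congr_fun fun n => ?_
  rw [PowerSeries.coeff_mk, sum_mul]
  refine sum_congr rfl fun q hq => ?_
  rw [← mem_antidiagonal.1 hq, pow_add]
  simp only [f, mul_pow, zsmul_eq_mul]
  ring

end HasExpansion

end NonarchimedeanPowerSeries

section DrinfeldHalfPlane

variable {F : Type*} [Field F] [Finite F]

/-! ### The geometry of `Ω` -/

section Field

instance instIsUltrametricDistKInfAlg : IsUltrametricDist (KInfAlg F) :=
  IsUltrametricDist.isUltrametricDist_of_isNonarchimedean_norm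
    (isNonarchimedean_spectralNorm (K := KInf F) (L := KInfAlg F))

instance instIsUltrametricDistCInf : IsUltrametricDist (CInf F) :=
  IsUltrametricDist.isUltrametricDist_of_forall_norm_add_le_max_norm fun x y => by
    refine UniformSpace.Completion.induction_on₂ x y
      (isClosed_le (by fun_prop) (by fun_prop)) fun a b => ?_
    rw [← UniformSpace.Completion.coe_add]
    simpa only [UniformSpace.Completion.norm_coe] using IsUltrametricDist.norm_add_le_max a b

lemma natCast_card_pow_sub_one (L : Type*) [Ring L] [Algebra F L] {s : ℕ} (hs : s ≠ 0) :
    ((Nat.card F ^ s - 1 : ℕ) : L) = -1 := by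
  have := Fintype.ofFinite F
  have natCast_card : (Nat.card F : L) = 0 := by
    rw [← map_natCast (algebraMap F L), Nat.card_eq_fintype_card, Nat.cast_card_eq_zero, map_zero]
  rw [Nat.cast_sub (Nat.one_le_pow _ _ Nat.card_pos), Nat.cast_pow, natCast_card, zero_pow hs,
    Nat.cast_one, zero_sub]

instance instHasLargeRootsOfUnityCInf : HasLargeRootsOfUnity (CInf F) where
  exists_isPrimitiveRoot N₀ := by
    obtain ⟨s, hs⟩ := pow_unbounded_of_one_lt (N₀ + 1) (Finite.one_lt_card (α := F))
    have hs0 : s ≠ 0 := by rintro rfl; simp at hs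
    let φ : F →+* KInfAlg F := (algebraMap (RatFunc F) (KInfAlg F)).comp (algebraMap F (RatFunc F))
    let _ := φ.toAlgebra
    let _ := ((algebraMap (KInfAlg F) (CInf F)).comp φ).toAlgebra
    have : NeZero ((Nat.card F ^ s - 1 : ℕ) : KInfAlg F) :=
      ⟨by simp [natCast_card_pow_sub_one (F := F) _ hs0]⟩
    obtain ⟨ζ, hζ⟩ := HasEnoughRootsOfUnity.exists_primitiveRoot (KInfAlg F) (Nat.card F ^ s - 1)
    exact ⟨Nat.card F ^ s - 1, by lia, by simp [natCast_card_pow_sub_one (F := F) (CInf F) hs0], _,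
      hζ.map_of_injective (algebraMap (KInfAlg F) (CInf F)).injective⟩

lemma exists_norm_lt_CInf {r : ℝ} (hr : 0 < r) : ∃ c : CInf F, c ≠ 0 ∧ ‖c‖ < r := by
  obtain ⟨x, hx, hxr⟩ := NormedField.exists_norm_lt (KInf F) hr
  exact ⟨algebraMap (KInf F) (CInf F) x, norm_pos_iff.1 (by simpa using hx), by simpa using hxr⟩

end Field

section Geometry

lemma imagAbs_le (z : Omega F) (x : KInf F) :
    imagAbs z ≤ ‖(z : CInf F) - algebraMap (KInf F) (CInf F) x‖ :=
  ciInf_le ⟨0, Set.forall_mem_range.2 fun _ => norm_nonneg _⟩ x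

lemma imagAbs_pos (z : Omega F) : 0 < imagAbs z := by
  have isClosed_range : IsClosed (Set.range (algebraMap (KInf F) (CInf F))) :=
    (algebraMap_isometry (KInf F) (CInf F)).isClosedEmbedding.isClosed_range
  obtain ⟨r, hr, hball⟩ := Metric.isOpen_iff.1 isClosed_range.isOpen_compl z z.2
  refine hr.trans_le (le_ciInf fun x => ?_)
  by_contra! hx
  exact hball (by rwa [Metric.mem_ball, dist_eq_norm, norm_sub_rev]) ⟨x, rfl⟩

lemma norm_mul_imagAbs_le (c d : KInf F) (z : Omega F) :
    ‖c‖ * imagAbs z ≤ ‖algebraMap (KInf F) (CInf F) c * z + algebraMap (KInf F) (CInf F) d‖ := by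
  rcases eq_or_ne c 0 with rfl | hc
  · simp
  have hc' : algebraMap (KInf F) (CInf F) c ≠ 0 := (_root_.map_ne_zero _).2 hc
  have factor : algebraMap (KInf F) (CInf F) c * z + algebraMap (KInf F) (CInf F) d =
      algebraMap (KInf F) (CInf F) c * (z - algebraMap (KInf F) (CInf F) (-d / c)) := by
    rw [map_div₀, map_neg]; field_simp; ring
  rw [factor, norm_mul, norm_algebraMap']
  exact mul_le_mul_of_nonneg_left (imagAbs_le z _) (norm_nonneg _)

lemma norm_det_mul_imagAbs_le (a b c d : KInf F) (z : Omega F) :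
    ‖a * d - b * c‖ * imagAbs z ≤
      ‖algebraMap (KInf F) (CInf F) a * z + algebraMap (KInf F) (CInf F) b‖ *
        ‖algebraMap (KInf F) (CInf F) c * z + algebraMap (KInf F) (CInf F) d‖ := by
  set L := algebraMap (KInf F) (CInf F) a * z + algebraMap (KInf F) (CInf F) b
  set L' := algebraMap (KInf F) (CInf F) c * z + algebraMap (KInf F) (CInf F) d
  have elimination : algebraMap (KInf F) (CInf F) (a * d - b * c) =
      algebraMap (KInf F) (CInf F) a * L' - algebraMap (KInf F) (CInf F) c * L := by
    simp only [L, L', map_sub, map_mul]; ring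
  rw [← norm_algebraMap' (CInf F), elimination, sub_eq_add_neg]
  refine (mul_le_mul_of_nonneg_right (IsUltrametricDist.norm_add_le_max _ _)
    (imagAbs_pos z).le).trans ?_
  rw [norm_neg, norm_mul, norm_mul, norm_algebraMap', norm_algebraMap',
    max_mul_of_nonneg _ _ (imagAbs_pos z).le]
  have hL : ‖a‖ * imagAbs z ≤ ‖L‖ := norm_mul_imagAbs_le a b z
  have hL' : ‖c‖ * imagAbs z ≤ ‖L'‖ := norm_mul_imagAbs_le c d z
  exact max_le (by nlinarith [norm_nonneg L']) (by nlinarith [norm_nonneg L])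

lemma norm_sub_eq_of_norm_sub_lt {z : Omega F} {w : CInf F} (h : ‖w - z‖ < imagAbs z)
    (x : KInf F) :
    ‖w - algebraMap (KInf F) (CInf F) x‖ = ‖(z : CInf F) - algebraMap (KInf F) (CInf F) x‖ := by
  have hx := h.trans_le (imagAbs_le z x)
  rw [← sub_add_sub_cancel w (z : CInf F),
    IsUltrametricDist.norm_add_eq_max_of_norm_ne_norm hx.ne, max_eq_right hx.le]

lemma notMem_range_of_norm_sub_lt {z : Omega F} {w : CInf F} (h : ‖w - z‖ < imagAbs z) :
    w ∉ Set.range (algebraMap (KInf F) (CInf F)) := by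
  rintro ⟨x, rfl⟩
  have hx := norm_sub_eq_of_norm_sub_lt h x
  rw [sub_self, norm_zero] at hx
  exact (imagAbs_pos z).not_ge (hx ▸ imagAbs_le z x)

lemma imagAbs_eq_of_norm_sub_lt {z w : Omega F} (h : ‖(w : CInf F) - z‖ < imagAbs z) :
    imagAbs w = imagAbs z :=
  iInf_congr fun x => norm_sub_eq_of_norm_sub_lt h x

lemma one_lt_natCast_card : (1 : ℝ) < Nat.card F := by
  exact_mod_cast Finite.one_lt_card

lemma closedBall_subset_affinoid {N : ℕ} {z : Omega F} (hz : z ∈ affinoid F N) {r : ℝ}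
    (hr : r < ((Nat.card F : ℝ) ^ N)⁻¹) :
    Metric.closedBall (z : CInf F) r ⊆ (↑) '' affinoid F N := fun w hw => by
  rw [mem_closedBall_iff_norm] at hw
  have hwz := (hw.trans_lt hr).trans_le hz.2
  let w' : Omega F := ⟨w, notMem_range_of_norm_sub_lt hwz⟩
  refine ⟨w', ⟨?_, hz.2.trans (imagAbs_eq_of_norm_sub_lt (w := w') hwz).ge⟩, rfl⟩
  have one_le : (1 : ℝ) ≤ (Nat.card F : ℝ) ^ N := one_le_pow₀ one_lt_natCast_card.le
  simpa using (IsUltrametricDist.norm_add_le_max (w - z) (z : CInf F)).trans (max_le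
    ((hw.trans hr.le).trans ((inv_le_one_of_one_le₀ one_le).trans one_le)) hz.1)

lemma exists_affinoid_of_bounds (B : ℝ) {r : ℝ} (hr : 0 < r) :
    ∃ N : ℕ, ∀ z : Omega F, ‖(z : CInf F)‖ ≤ B → r ≤ imagAbs z → z ∈ affinoid F N := by
  obtain ⟨N, hN⟩ := pow_unbounded_of_one_lt (max B r⁻¹) (one_lt_natCast_card (F := F))
  rw [max_lt_iff] at hN
  exact ⟨N, fun z hB hr' => ⟨hB.trans hN.1.le, (inv_le_of_inv_le₀ hr hN.2.le).trans hr'⟩⟩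

lemma exists_closedBall_subset_affinoid {z : Omega F} {r : ℝ} (hr : r < imagAbs z) :
    ∃ N : ℕ, Metric.closedBall (z : CInf F) r ⊆ (↑) '' affinoid F N := by
  obtain ⟨N, hN⟩ := exists_affinoid_of_bounds (F := F) (max r ‖(z : CInf F)‖) (imagAbs_pos z)
  refine ⟨N, fun w hw => ?_⟩
  rw [mem_closedBall_iff_norm] at hw
  have hwz := hw.trans_lt hr
  refine ⟨⟨w, notMem_range_of_norm_sub_lt hwz⟩, hN _ ?_ (imagAbs_eq_of_norm_sub_lt hwz).ge, rfl⟩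
  simpa using (IsUltrametricDist.norm_add_le_max (w - z) (z : CInf F)).trans
    (max_le_max_right _ hw)

end Geometry

section Moebius

variable (γ : GL (Fin 2) (KInf F)) (z w : Omega F)

lemma detC_eq : detC γ = algebraMap (KInf F) (CInf F) (γ 0 0 * γ 1 1 - γ 0 1 * γ 1 0) := by
  rw [detC, Matrix.GeneralLinearGroup.val_det_apply, Matrix.det_fin_two]

lemma detC_ne_zero : detC γ ≠ 0 :=
  (_root_.map_ne_zero _).2 γ.det.ne_zero

lemma norm_detC_mul_imagAbs_le (x : KInf F) : ‖detC γ‖ * imagAbs z ≤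
    ‖(moebius γ z : CInf F) - algebraMap (KInf F) (CInf F) x‖ * ‖denom γ z‖ ^ 2 := by
  have hdenom := denom_ne_zero γ z
  have moebius_sub : (moebius γ z : CInf F) - algebraMap (KInf F) (CInf F) x =
      (algebraMap (KInf F) (CInf F) (γ 0 0 - x * γ 1 0) * z +
        algebraMap (KInf F) (CInf F) (γ 0 1 - x * γ 1 1)) / denom γ z := by
    rw [moebius, eq_div_iff hdenom, sub_mul, div_mul_cancel₀ _ hdenom]
    simp only [denom, map_sub, map_mul]
    ring
  have det_eq : γ 0 0 * γ 1 1 - γ 0 1 * γ 1 0 =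
      (γ 0 0 - x * γ 1 0) * γ 1 1 - (γ 0 1 - x * γ 1 1) * γ 1 0 := by ring
  rw [moebius_sub, norm_div, sq, ← mul_assoc, div_mul_cancel₀ _ (norm_ne_zero_iff.2 hdenom),
    detC_eq, norm_algebraMap', det_eq]
  exact norm_det_mul_imagAbs_le _ _ _ _ z

lemma imagAbs_moebius_ge : ‖detC γ‖ * imagAbs z / ‖denom γ z‖ ^ 2 ≤ imagAbs (moebius γ z) :=
  le_ciInf fun x => div_le_of_le_mul₀ (by positivity) (norm_nonneg _)
    (norm_detC_mul_imagAbs_le γ z x)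

lemma norm_kappa_mul_imagAbs_le : ‖kappa γ z‖ * imagAbs z ≤ 1 := by
  rw [kappa, norm_div, norm_algebraMap', div_mul_eq_mul_div]
  exact div_le_one_of_le₀ (norm_mul_imagAbs_le _ _ z) (norm_nonneg _)

lemma norm_kappa_mul_lt_one {ε : CInf F} (hε : ‖ε‖ < imagAbs z) : ‖kappa γ z * ε‖ < 1 := by
  rw [norm_mul]
  rcases (norm_nonneg (kappa γ z)).eq_or_lt with h | h
  · simp [← h]
  · exact (mul_lt_mul_of_pos_left hε h).trans_le (norm_kappa_mul_imagAbs_le γ z)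

lemma denom_eq_mul : denom γ w = denom γ z * (1 + kappa γ z * (w - z)) := by
  have hdenom := denom_ne_zero γ z
  rw [kappa, mul_add, mul_one, ← mul_assoc, mul_div_cancel₀ _ hdenom, denom, denom]
  ring

lemma one_add_kappa_mul_ne_zero : 1 + kappa γ z * (w - z) ≠ 0 :=
  right_ne_zero_of_mul (denom_eq_mul γ z w ▸ denom_ne_zero γ w)

lemma kappa_eq_div : kappa γ w = kappa γ z / (1 + kappa γ z * (w - z)) := by
  rw [kappa, denom_eq_mul γ z w, kappa, div_div]

lemma moebius_sub_moebius : (moebius γ w : CInf F) - moebius γ z =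
    detC γ / denom γ z ^ 2 * ((w - z) / (1 + kappa γ z * (w - z))) := by
  have hz := denom_ne_zero γ z
  have hw := denom_ne_zero γ w
  have h : (moebius γ w : CInf F) - moebius γ z = detC γ * (w - z) / (denom γ w * denom γ z) := by
    rw [moebius, moebius, div_sub_div _ _ hw hz, detC_eq]
    congr 1
    simp only [denom, map_sub, map_mul]
    ring
  rw [h, denom_eq_mul γ z w]
  field

lemma exists_mapsTo_affinoid (N : ℕ) :
    ∃ M, Set.MapsTo (moebius γ) (affinoid F N) (affinoid F M) := by
  set Q : ℝ := (Nat.card F : ℝ) ^ N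
  have hQ : 0 < Q := pow_pos (one_pos.trans one_lt_natCast_card) N
  have hdet : 0 < ‖detC γ‖ := norm_pos_iff.2 (detC_ne_zero γ)
  have linear_le (a b : KInf F) {z : Omega F} (hz : z ∈ affinoid F N) :
      ‖algebraMap (KInf F) (CInf F) a * z + algebraMap (KInf F) (CInf F) b‖ ≤ ‖a‖ * Q + ‖b‖ := by
    refine (norm_add_le _ _).trans ?_
    rw [norm_mul, norm_algebraMap', norm_algebraMap']
    gcongr
    exact hz.1
  set A := ‖γ 0 0‖ * Q + ‖γ 0 1‖
  set D := ‖γ 1 0‖ * Q + ‖γ 1 1‖ + 1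
  have : 0 < D := by positivity
  obtain ⟨M, hM⟩ := exists_affinoid_of_bounds (F := F) (Q * A ^ 2 / ‖detC γ‖)
    (r := ‖detC γ‖ * Q⁻¹ / D ^ 2) (by positivity)
  refine ⟨M, fun z hz => hM _ ?_ ((imagAbs_moebius_ge γ z).trans' ?_)⟩
  · have hA := linear_le (γ 0 0) (γ 0 1) hz
    have hdenom : 0 < ‖denom γ z‖ := norm_pos_iff.2 (denom_ne_zero γ z)
    have hdet_le : ‖detC γ‖ * Q⁻¹ ≤ A * ‖denom γ z‖ := by
      refine (mul_le_mul_of_nonneg_left hz.2 hdet.le).trans ?_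
      rw [detC_eq, norm_algebraMap']
      exact (norm_det_mul_imagAbs_le _ _ _ _ z).trans (by gcongr; rfl)
    rw [← div_eq_mul_inv, div_le_iff₀ hQ] at hdet_le
    rw [moebius, norm_div, div_le_div_iff₀ hdenom hdet]
    calc _ ≤ A * (A * ‖denom γ z‖ * Q) := by gcongr
      _ = Q * A ^ 2 * ‖denom γ z‖ := by ring
  · have hdenom := denom_ne_zero γ z
    gcongr
    · exact mul_nonneg hdet.le (imagAbs_pos z).le
    · exact hz.2
    · exact (linear_le _ _ hz).trans (le_add_of_nonneg_right zero_le_one)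

end Moebius

/-! ### Taylor expansions and rigid analytic functions -/

section TaylorExpansion

open scoped PowerSeries

variable {f : Omega F → CInf F} {z : Omega F}

/-- The function `ε ↦ f (z + ε)`, extended by zero to all of `ℂ_∞`. -/
def translate (f : Omega F → CInf F) (z : Omega F) (ε : CInf F) : CInf F :=
  Function.extend Subtype.val f 0 (z + ε)

lemma translate_sub (f : Omega F → CInf F) (z w : Omega F) : translate f z (w - z) = f w := by
  rw [translate, add_sub_cancel]
  exact Subtype.val_injective.extend_apply f 0 w

lemma translate_add (f g : Omega F → CInf F) (z : Omega F) :
    translate (f + g) z = translate f z + translate g z :=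
  funext fun ε => by
    have extend_add := congrFun (Function.extend_add Subtype.val f g 0 0) ((z : CInf F) + ε)
    rwa [add_zero] at extend_add

lemma translate_mul (f g : Omega F → CInf F) (z : Omega F) :
    translate (f * g) z = translate f z * translate g z :=
  funext fun ε => by
    have extend_mul := congrFun (Function.extend_mul Subtype.val f g 0 0) ((z : CInf F) + ε)
    rwa [mul_zero] at extend_mul

lemma exists_mem_sub_eq {s : Set (Omega F)} {r : ℝ}
    (hs : Metric.closedBall (z : CInf F) r ⊆ (↑) '' s) {ε : CInf F} (hε : ‖ε‖ ≤ r) :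
    ∃ w ∈ s, (w : CInf F) - z = ε := by
  obtain ⟨w, hw, hwε⟩ := hs (a := z + ε) (by simpa using hε)
  exact ⟨w, hw, by rw [hwε, add_sub_cancel_left]⟩

lemma exists_sub_eq {ε : CInf F} (hε : ‖ε‖ < imagAbs z) : ∃ w : Omega F, (w : CInf F) - z = ε := by
  obtain ⟨N, hN⟩ := exists_closedBall_subset_affinoid hε
  obtain ⟨w, -, hw⟩ := exists_mem_sub_eq hN le_rfl
  exact ⟨w, hw⟩

lemma hasTaylorCoeffs_iff {a : ℕ → CInf F} : HasTaylorCoeffs f z a ↔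
    ∃ c ≠ 0, HasExpansion c (translate f z) (PowerSeries.mk a) := by
  constructor
  · rintro ⟨r, hr, h⟩
    obtain ⟨c, hc, hcr⟩ := exists_norm_lt_CInf (F := F) (lt_min hr (imagAbs_pos z))
    refine ⟨c, hc, fun ε hε => ?_⟩
    obtain ⟨w, rfl⟩ := exists_sub_eq (hε.trans_lt (hcr.trans_le (min_le_right _ _)))
    simpa only [translate_sub, PowerSeries.coeff_mk] using
      h w (hε.trans_lt (hcr.trans_le (min_le_left _ _)))
  · rintro ⟨c, hc, h⟩
    exact ⟨‖c‖, norm_pos_iff.2 hc, fun w hw => by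
      simpa only [translate_sub, PowerSeries.coeff_mk] using h (w - z) hw.le⟩

lemma HasExpansion.hyperDeriv_eq {c : CInf F} (hc : c ≠ 0) {p : (CInf F)⟦X⟧}
    (h : HasExpansion c (translate f z) p) (n : ℕ) :
    hyperDeriv n f z = PowerSeries.coeff n p := by
  have hex : ∃ a, HasTaylorCoeffs f z a :=
    ⟨fun n => PowerSeries.coeff n p, hasTaylorCoeffs_iff.2 ⟨c, hc, by
      simpa only [HasExpansion, PowerSeries.coeff_mk] using h⟩⟩
  obtain ⟨c', hc', h'⟩ := hasTaylorCoeffs_iff.1 hex.choose_spec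
  have mk_eq : PowerSeries.mk hex.choose = p := by
    rcases le_total ‖c‖ ‖c'‖ with hle | hle
    · exact (h'.mono hle).unique hc h
    · exact h'.unique hc' (h.mono hle)
  rw [hyperDeriv, dif_pos hex, ← mk_eq, PowerSeries.coeff_mk]

end TaylorExpansion

section RegularFunctions

open scoped PowerSeries

variable {M N : ℕ} {g : Omega F → CInf F}

variable (F N) in
/-- The algebra of rational functions without poles in the affinoid `Ω_N`. -/
def regularFunctions : Subalgebra (CInf F) (Omega F → CInf F) :=
  Algebra.adjoin (CInf F) (insert (↑)
    {g | ∃ a : CInf F, a ∉ (↑) '' affinoid F N ∧ g = fun z : Omega F => ((z : CInf F) - a)⁻¹})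

lemma coe_mem_regularFunctions : (fun z : Omega F => (z : CInf F)) ∈ regularFunctions F N :=
  Algebra.subset_adjoin (Set.mem_insert _ _)

lemma inv_sub_mem_regularFunctions {a : CInf F} (ha : a ∉ (↑) '' affinoid F N) :
    (fun z : Omega F => ((z : CInf F) - a)⁻¹) ∈ regularFunctions F N :=
  Algebra.subset_adjoin (Set.mem_insert_of_mem _ ⟨a, ha, rfl⟩)

lemma const_mem_regularFunctions (a : CInf F) :
    (fun _ : Omega F => a) ∈ regularFunctions F N :=
  (regularFunctions F N).algebraMap_mem a

@[elab_as_elim]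
lemma regularFunctions_induction {p : (g : Omega F → CInf F) → g ∈ regularFunctions F N → Prop}
    (const : ∀ a, p _ (const_mem_regularFunctions a)) (coe : p _ coe_mem_regularFunctions)
    (inv : ∀ (a : CInf F) (ha : a ∉ (↑) '' affinoid F N), p _ (inv_sub_mem_regularFunctions ha))
    (add : ∀ g g' hg hg', p g hg → p g' hg' → p (g + g') (add_mem hg hg'))
    (mul : ∀ g g' hg hg', p g hg → p g' hg' → p (g * g') (mul_mem hg hg'))
    (hg : g ∈ regularFunctions F N) : p g hg := by
  refine Algebra.adjoin_induction ?_ const add mul hg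
  rintro g (rfl | ⟨a, ha, rfl⟩)
  exacts [coe, inv a ha]

lemma linear_mem_regularFunctions (a b : CInf F) :
    (fun z : Omega F => a * (z : CInf F) + b) ∈ regularFunctions F N :=
  add_mem (mul_mem (const_mem_regularFunctions a) coe_mem_regularFunctions)
    (const_mem_regularFunctions b)

lemma inv_linear_mem_regularFunctions {a b : CInf F}
    (h : ∀ z ∈ affinoid F N, a * (z : CInf F) + b ≠ 0) :
    (fun z : Omega F => (a * (z : CInf F) + b)⁻¹) ∈ regularFunctions F N := by
  rcases eq_or_ne a 0 with rfl | ha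
  · simpa only [zero_mul, zero_add] using const_mem_regularFunctions b⁻¹
  have factor (z : CInf F) : a * z + b = a * (z - -b / a) := by field
  have root_notMem : -b / a ∉ (↑) '' affinoid F N := by
    rintro ⟨z, hz, hza⟩
    exact h z hz (by rw [factor, hza, sub_self, mul_zero])
  simp only [factor, mul_inv]
  exact mul_mem (const_mem_regularFunctions a⁻¹) (inv_sub_mem_regularFunctions root_notMem)

lemma eval_mem_regularFunctions (P : (CInf F)[X]) :
    (fun z : Omega F => P.eval (z : CInf F)) ∈ regularFunctions F N := by
  convert (aeval (⟨_, coe_mem_regularFunctions⟩ : regularFunctions F N) P).2 using 1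
  ext z
  rw [aeval_subalgebra_coe, aeval_fn_apply, coe_aeval_eq_eval]

lemma eval_multiset_prod_X_sub_C (s : Multiset (CInf F)) (z : CInf F) :
    (s.map fun a => X - C a).prod.eval z = (s.map fun a => z - a).prod := by
  simp [eval_multiset_prod]

lemma multiset_prod_sub_ne_zero {s : Multiset (CInf F)} {z : CInf F} (hz : z ∉ s) :
    (s.map fun a => z - a).prod ≠ 0 := by
  simpa [Multiset.prod_eq_zero_iff, sub_eq_zero] using hz

lemma exists_eq_div_of_mem_regularFunctions (hg : g ∈ regularFunctions F N) :
    ∃ (P : (CInf F)[X]) (s : Multiset (CInf F)), (∀ z ∈ affinoid F N, (z : CInf F) ∉ s) ∧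
      ∀ z ∈ affinoid F N, g z = P.eval (z : CInf F) / (s.map fun a => (z : CInf F) - a).prod := by
  induction hg using regularFunctions_induction with
  | const a => exact ⟨C a, 0, by simp, by simp⟩
  | coe => exact ⟨X, 0, by simp, by simp⟩
  | inv a ha =>
    exact ⟨1, {a}, fun z hz hza => ha ⟨z, hz, Multiset.mem_singleton.1 hza⟩, by simp⟩
  | add g g' _ _ ih ih' =>
    obtain ⟨P, s, hs, hP⟩ := ih
    obtain ⟨P', s', hs', hP'⟩ := ih'
    refine ⟨P * (s'.map fun a => X - C a).prod + (s.map fun a => X - C a).prod * P', s + s',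
      fun z hz => by simp [hs z hz, hs' z hz], fun z hz => ?_⟩
    rw [Pi.add_apply, hP z hz, hP' z hz, div_add_div _ _ (multiset_prod_sub_ne_zero (hs z hz))
      (multiset_prod_sub_ne_zero (hs' z hz)), Multiset.map_add, Multiset.prod_add, eval_add,
      eval_mul, eval_mul, eval_multiset_prod_X_sub_C, eval_multiset_prod_X_sub_C]
  | mul g g' _ _ ih ih' =>
    obtain ⟨P, s, hs, hP⟩ := ih
    obtain ⟨P', s', hs', hP'⟩ := ih'
    refine ⟨P * P', s + s', fun z hz => by simp [hs z hz, hs' z hz], fun z hz => ?_⟩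
    rw [Pi.mul_apply, hP z hz, hP' z hz, div_mul_div_comm, Multiset.map_add, Multiset.prod_add,
      eval_mul]

lemma isRigidAnalytic_iff {f : Omega F → CInf F} : IsRigidAnalytic f ↔
    ∀ (N : ℕ) (δ : ℝ), 0 < δ → ∃ g ∈ regularFunctions F N, ∀ z ∈ affinoid F N, ‖f z - g z‖ < δ := by
  refine forall₃_congr fun N δ _ => ⟨?_, ?_⟩
  · rintro ⟨P, s, hs, hf⟩
    refine ⟨_ * (s.map fun a (z : Omega F) => ((z : CInf F) - a)⁻¹).prod,
      mul_mem (eval_mem_regularFunctions P) (multiset_prod_mem _ fun g hg => ?_), fun z hz => ?_⟩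
    · obtain ⟨a, ha, rfl⟩ := Multiset.mem_map.1 hg
      exact inv_sub_mem_regularFunctions fun ⟨z, hz, hza⟩ => hs z hz (hza ▸ ha)
    · rw [Pi.mul_apply, Pi.multiset_prod_apply, Multiset.map_map]
      simpa only [Function.comp_def, Multiset.prod_map_inv, div_eq_mul_inv] using hf z hz
  · rintro ⟨g, hg, hf⟩
    obtain ⟨P, s, hs, hP⟩ := exists_eq_div_of_mem_regularFunctions hg
    exact ⟨P, s, hs, fun z hz => hP z hz ▸ hf z hz⟩

lemma lt_norm_sub_of_closedBall_subset {s : Set (Omega F)} {z a : CInf F} {r : ℝ}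
    (hs : Metric.closedBall z r ⊆ (↑) '' s) (ha : a ∉ (↑) '' s) : r < ‖z - a‖ := by
  by_contra! h
  exact ha (hs (mem_closedBall_iff_norm'.2 h))

lemma exists_norm_le_of_mem_regularFunctions (hg : g ∈ regularFunctions F N) :
    ∃ B, ∀ z ∈ affinoid F N, ‖g z‖ ≤ B := by
  induction hg using regularFunctions_induction with
  | const a => exact ⟨‖a‖, fun _ _ => le_rfl⟩
  | coe => exact ⟨_, fun z hz => hz.1⟩
  | inv a ha =>
    have hr : 0 < ((Nat.card F : ℝ) ^ N)⁻¹ := by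
      have := one_lt_natCast_card (F := F)
      positivity
    refine ⟨(((Nat.card F : ℝ) ^ N)⁻¹ / 2)⁻¹, fun z hz => ?_⟩
    rw [norm_inv]
    exact inv_anti₀ (half_pos hr) (lt_norm_sub_of_closedBall_subset
      (closedBall_subset_affinoid hz (half_lt_self hr)) ha).le
  | add g g' _ _ ih ih' =>
    obtain ⟨B, hB⟩ := ih
    obtain ⟨B', hB'⟩ := ih'
    exact ⟨B + B', fun z hz => norm_add_le_of_le (hB z hz) (hB' z hz)⟩
  | mul g g' _ _ ih ih' =>
    obtain ⟨B, hB⟩ := ih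
    obtain ⟨B', hB'⟩ := ih'
    exact ⟨B * B', fun z hz => norm_mul_le_of_le (hB z hz) (hB' z hz)⟩

variable (N) in
/-- Evaluation at `z`, as a ring homomorphism on the functions regular on `Ω_N`. -/
def evalRegular (z : Omega F) : regularFunctions F N →+* CInf F :=
  (Pi.evalRingHom _ z).comp (regularFunctions F N).val.toRingHom

lemma evalRegular_apply (z : Omega F) (G : regularFunctions F N) :
    evalRegular N z G = (G : Omega F → CInf F) z := rfl

lemma hasExpansion_translate_inv_sub {z : Omega F} {a c : CInf F} (h : ‖c‖ < ‖(z : CInf F) - a‖) :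
    HasExpansion c (fun ε => ((z : CInf F) + ε - a)⁻¹)
      (((z : CInf F) - a)⁻¹ • PowerSeries.rescale ((z : CInf F) - a)⁻¹
        (PowerSeries.binomialSeries (CInf F) (-1 : ℤ))) := by
  have hza : (z : CInf F) - a ≠ 0 := norm_pos_iff.1 ((norm_nonneg c).trans_lt h)
  have hc : ‖((z : CInf F) - a)⁻¹ * c‖ < 1 := by
    rw [norm_mul, norm_inv]
    exact (inv_mul_lt_one₀ ((norm_nonneg c).trans_lt h)).2 h
  refine (((HasExpansion.one_add_zpow hc (-1)).rescale le_rfl).const_mul _).congr fun ε _ => ?_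
  rw [zpow_neg_one, ← mul_inv]
  congr 1
  field

/-- That the coefficients are again regular on `Ω_N`, as functions of the centre `z`, makes the
hyperderivatives of a rigid analytic function uniform limits of regular functions. -/
lemma exists_hasExpansion_of_mem_regularFunctions (hg : g ∈ regularFunctions F N) :
    ∃ G : (regularFunctions F N)⟦X⟧, ∀ (z : Omega F) (c : CInf F),
      Metric.closedBall (z : CInf F) ‖c‖ ⊆ (↑) '' affinoid F N →
        HasExpansion c (translate g z) (PowerSeries.map (evalRegular N z) G) := by
  induction hg using regularFunctions_induction with
  | const a =>
    refine ⟨PowerSeries.C ⟨_, const_mem_regularFunctions a⟩, fun z c hs => ?_⟩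
    rw [PowerSeries.map_C]
    refine (HasExpansion.const c a).congr fun ε hε => ?_
    obtain ⟨w, -, rfl⟩ := exists_mem_sub_eq hs hε
    rw [translate_sub]
  | coe =>
    refine ⟨PowerSeries.C ⟨_, coe_mem_regularFunctions⟩ + PowerSeries.X, fun z c hs => ?_⟩
    rw [map_add, PowerSeries.map_C, PowerSeries.map_X]
    refine ((HasExpansion.const c (z : CInf F)).add (.id c)).congr fun ε hε => ?_
    obtain ⟨w, -, rfl⟩ := exists_mem_sub_eq hs hε
    simp [translate_sub]
  | inv a ha =>
    let h : regularFunctions F N := ⟨_, inv_sub_mem_regularFunctions ha⟩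
    refine ⟨PowerSeries.C h * PowerSeries.rescale h (PowerSeries.binomialSeries _ (-1 : ℤ)),
      fun z c hs => ?_⟩
    convert (hasExpansion_translate_inv_sub
      (lt_norm_sub_of_closedBall_subset hs ha)).congr fun ε hε => ?_ using 1
    · ext n
      simp [h, evalRegular_apply, PowerSeries.coeff_rescale]
    · obtain ⟨w, -, rfl⟩ := exists_mem_sub_eq hs hε
      rw [translate_sub, add_sub_cancel]
  | add g g' _ _ ih ih' =>
    obtain ⟨G, hG⟩ := ih
    obtain ⟨G', hG'⟩ := ih'
    refine ⟨G + G', fun z c hs => ?_⟩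
    rw [translate_add, map_add]
    exact (hG z c hs).add (hG' z c hs)
  | mul g g' _ _ ih ih' =>
    obtain ⟨G, hG⟩ := ih
    obtain ⟨G', hG'⟩ := ih'
    refine ⟨G * G', fun z c hs => ?_⟩
    rw [translate_mul, map_mul]
    exact (hG z c hs).mul (hG' z c hs)

variable {γ : GL (Fin 2) (KInf F)}

lemma inv_denom_mem_regularFunctions : (denom γ)⁻¹ ∈ regularFunctions F N :=
  inv_linear_mem_regularFunctions fun z _ => denom_ne_zero γ z

lemma comp_moebius_mem_regularFunctions (hγ : Set.MapsTo (moebius γ) (affinoid F N) (affinoid F M))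
    (hg : g ∈ regularFunctions F M) : g ∘ moebius γ ∈ regularFunctions F N := by
  induction hg using regularFunctions_induction with
  | const a => exact const_mem_regularFunctions a
  | coe => exact mul_mem (linear_mem_regularFunctions _ _) inv_denom_mem_regularFunctions
  | inv a ha =>
    have moebius_sub (z : Omega F) : (moebius γ z : CInf F) - a =
        ((algebraMap (KInf F) (CInf F) (γ 0 0) - a * algebraMap (KInf F) (CInf F) (γ 1 0)) * z +
          (algebraMap (KInf F) (CInf F) (γ 0 1) - a * algebraMap (KInf F) (CInf F) (γ 1 1))) /
            denom γ z := by
      rw [eq_div_iff (denom_ne_zero γ z), moebius, sub_mul, div_mul_cancel₀ _ (denom_ne_zero γ z),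
        denom]
      ring
    have inv_eq : (fun z : Omega F => ((z : CInf F) - a)⁻¹) ∘ moebius γ = fun z =>
        denom γ z * ((algebraMap (KInf F) (CInf F) (γ 0 0) -
          a * algebraMap (KInf F) (CInf F) (γ 1 0)) * z + (algebraMap (KInf F) (CInf F) (γ 0 1) -
            a * algebraMap (KInf F) (CInf F) (γ 1 1)))⁻¹ :=
      funext fun z => by rw [Function.comp_apply, moebius_sub, inv_div, div_eq_mul_inv]
    rw [inv_eq]
    refine mul_mem (linear_mem_regularFunctions _ _) (inv_linear_mem_regularFunctions
      fun z hz h => ha ⟨moebius γ z, hγ hz, ?_⟩)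
    rw [← sub_eq_zero, moebius_sub, h, zero_div]
  | add g g' _ _ ih ih' => exact add_mem ih ih'
  | mul g g' _ _ ih ih' => exact mul_mem ih ih'

end RegularFunctions

section RigidAnalytic

open scoped PowerSeries

variable {f g : Omega F → CInf F} {z : Omega F} {c : CInf F}

lemma isRigidAnalytic_of_mem_regularFunctions (hf : ∀ N, f ∈ regularFunctions F N) :
    IsRigidAnalytic f :=
  isRigidAnalytic_iff.2 fun N δ hδ => ⟨f, hf N, fun z _ => by rwa [sub_self, norm_zero]⟩

lemma IsRigidAnalytic.exists_norm_le (hf : IsRigidAnalytic f) (N : ℕ) :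
    ∃ B, 0 < B ∧ ∀ z ∈ affinoid F N, ‖f z‖ ≤ B := by
  obtain ⟨g, hg, hfg⟩ := isRigidAnalytic_iff.1 hf N 1 one_pos
  obtain ⟨B, hB⟩ := exists_norm_le_of_mem_regularFunctions hg
  refine ⟨max 1 B, by positivity, fun z hz => ?_⟩
  rw [← sub_add_cancel (f z) (g z)]
  exact (IsUltrametricDist.norm_add_le_max _ _).trans (max_le_max (hfg z hz).le (hB z hz))

lemma IsRigidAnalytic.add (hf : IsRigidAnalytic f) (hg : IsRigidAnalytic g) :
    IsRigidAnalytic (f + g) := by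
  rw [isRigidAnalytic_iff] at hf hg ⊢
  intro N δ hδ
  obtain ⟨f', hf', hff'⟩ := hf N δ hδ
  obtain ⟨g', hg', hgg'⟩ := hg N δ hδ
  refine ⟨f' + g', add_mem hf' hg', fun z hz => ?_⟩
  rw [Pi.add_apply, Pi.add_apply, add_sub_add_comm]
  exact (IsUltrametricDist.norm_add_le_max _ _).trans_lt (max_lt (hff' z hz) (hgg' z hz))

lemma IsRigidAnalytic.mul (hf : IsRigidAnalytic f) (hg : IsRigidAnalytic g) :
    IsRigidAnalytic (f * g) := by
  refine isRigidAnalytic_iff.2 fun N δ hδ => ?_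
  obtain ⟨B, hB, hfB⟩ := hf.exists_norm_le N
  obtain ⟨g', hg', hgg'⟩ := isRigidAnalytic_iff.1 hg N (δ / B) (by positivity)
  obtain ⟨B₀, hB₀⟩ := exists_norm_le_of_mem_regularFunctions hg'
  set B' := max 1 B₀
  have hB' : 0 < B' := by positivity
  have hgB' (z) (hz : z ∈ affinoid F N) : ‖g' z‖ ≤ B' := (hB₀ z hz).trans (le_max_right _ _)
  obtain ⟨f', hf', hff'⟩ := isRigidAnalytic_iff.1 hf N (δ / B') (by positivity)
  refine ⟨f' * g', mul_mem hf' hg', fun z hz => ?_⟩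
  have split : f z * g z - f' z * g' z = f z * (g z - g' z) + (f z - f' z) * g' z := by ring
  rw [Pi.mul_apply, Pi.mul_apply, split]
  refine (IsUltrametricDist.norm_add_le_max _ _).trans_lt (max_lt ?_ ?_)
  · rw [norm_mul]
    exact (mul_le_mul_of_nonneg_right (hfB z hz) (norm_nonneg _)).trans_lt
      ((lt_div_iff₀' hB).1 (hgg' z hz))
  · rw [norm_mul]
    exact (mul_le_mul_of_nonneg_left (hgB' z hz) (norm_nonneg _)).trans_lt
      ((lt_div_iff₀ hB').1 (hff' z hz))

variable (F) in
/-- The algebra of rigid analytic functions on `Ω`. -/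
def rigidFunctions : Subalgebra (CInf F) (Omega F → CInf F) where
  carrier := {f | IsRigidAnalytic f}
  add_mem' := IsRigidAnalytic.add
  mul_mem' := IsRigidAnalytic.mul
  algebraMap_mem' a := isRigidAnalytic_of_mem_regularFunctions fun _ => const_mem_regularFunctions a

lemma isRigidAnalytic_denom_zpow (γ : GL (Fin 2) (KInf F)) (k : ℤ) :
    IsRigidAnalytic (denom γ ^ k) := by
  have denom_mem : denom γ ∈ rigidFunctions F :=
    isRigidAnalytic_of_mem_regularFunctions fun _ => linear_mem_regularFunctions _ _
  have inv_denom_mem : (denom γ)⁻¹ ∈ rigidFunctions F :=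
    isRigidAnalytic_of_mem_regularFunctions fun _ => inv_denom_mem_regularFunctions
  obtain ⟨n, rfl | rfl⟩ := k.eq_nat_or_neg
  · rw [zpow_natCast]
    exact pow_mem denom_mem n
  · rw [zpow_neg, zpow_natCast, ← inv_pow]
    exact pow_mem inv_denom_mem n

lemma isRigidAnalytic_kappa (γ : GL (Fin 2) (KInf F)) : IsRigidAnalytic (kappa γ) := by
  have kappa_eq : kappa γ = algebraMap (KInf F) (CInf F) (γ 1 0) • denom γ ^ (-1 : ℤ) := by
    rw [zpow_neg_one]
    exact funext fun z => div_eq_mul_inv _ _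
  rw [kappa_eq]
  exact (rigidFunctions F).smul_mem (isRigidAnalytic_denom_zpow γ (-1)) _

lemma IsRigidAnalytic.slash (hf : IsRigidAnalytic f) (k m : ℤ) (γ : GL (Fin 2) (KInf F)) :
    IsRigidAnalytic (slash k m f γ) := by
  have comp_moebius : IsRigidAnalytic (f ∘ moebius γ) := isRigidAnalytic_iff.2 fun N δ hδ => by
    obtain ⟨M, hM⟩ := exists_mapsTo_affinoid γ N
    obtain ⟨g, hg, hfg⟩ := isRigidAnalytic_iff.1 hf M δ hδ
    exact ⟨_, comp_moebius_mem_regularFunctions hM hg, fun z hz => hfg _ (hM hz)⟩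
  exact ((rigidFunctions F).smul_mem (isRigidAnalytic_denom_zpow γ (-k)) (detC γ ^ m)).mul
    comp_moebius

/-- The power series `∑ (𝒟_n f)(z) ε^n`. -/
def taylorSeries (f : Omega F → CInf F) (z : Omega F) : (CInf F)⟦X⟧ :=
  PowerSeries.mk fun n => hyperDeriv n f z

lemma coeff_taylorSeries (n : ℕ) (f : Omega F → CInf F) (z : Omega F) :
    PowerSeries.coeff n (taylorSeries f z) = hyperDeriv n f z :=
  PowerSeries.coeff_mk n _

lemma HasExpansion.eq_taylorSeries (hc : c ≠ 0) {p : (CInf F)⟦X⟧}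
    (h : HasExpansion c (translate f z) p) : p = taylorSeries f z :=
  PowerSeries.ext fun n => by rw [coeff_taylorSeries, h.hyperDeriv_eq hc]

lemma IsRigidAnalytic.hasExpansion (hf : IsRigidAnalytic f) (hc : ‖c‖ < imagAbs z) :
    HasExpansion c (translate f z) (taylorSeries f z) := by
  obtain ⟨b, hb, hcb, hbz⟩ : ∃ b : CInf F, b ≠ 0 ∧ ‖c‖ ≤ ‖b‖ ∧ ‖b‖ < imagAbs z := by
    rcases eq_or_ne c 0 with rfl | hc0
    · obtain ⟨b, hb, hbz⟩ := exists_norm_lt_CInf (F := F) (imagAbs_pos z)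
      exact ⟨b, hb, by simp, hbz⟩
    · exact ⟨c, hc0, le_rfl, hc⟩
  suffices h : ∃ p, HasExpansion b (translate f z) p by
    obtain ⟨p, hp⟩ := h
    exact (hp.eq_taylorSeries hb ▸ hp).mono hcb
  obtain ⟨N, hN⟩ := exists_closedBall_subset_affinoid hbz
  refine HasExpansion.exists_of_forall_norm_sub_le hb fun δ hδ => ?_
  obtain ⟨g, hg, hfg⟩ := isRigidAnalytic_iff.1 hf N δ hδ
  obtain ⟨G, hG⟩ := exists_hasExpansion_of_mem_regularFunctions hg
  refine ⟨_, _, hG z b hN, fun ε hε => ?_⟩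
  obtain ⟨w, hw, rfl⟩ := exists_mem_sub_eq hN hε
  simpa only [translate_sub] using (hfg w hw).le

lemma isRigidAnalytic_hyperDeriv (hf : IsRigidAnalytic f) (n : ℕ) :
    IsRigidAnalytic (hyperDeriv n f) := by
  refine isRigidAnalytic_iff.2 fun N δ hδ => ?_
  have radius_pos : 0 < ((Nat.card F : ℝ) ^ N)⁻¹ :=
    inv_pos.2 (pow_pos (one_pos.trans one_lt_natCast_card) N)
  obtain ⟨c, hc, hcN⟩ := exists_norm_lt_CInf (F := F) radius_pos
  have hcn : 0 < ‖c ^ n‖ := norm_pos_iff.2 (pow_ne_zero n hc)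
  obtain ⟨g, hg, hfg⟩ := isRigidAnalytic_iff.1 hf N (δ / 2 * ‖c ^ n‖) (by positivity)
  obtain ⟨G, hG⟩ := exists_hasExpansion_of_mem_regularFunctions hg
  refine ⟨_, (PowerSeries.coeff n G).2, fun z hz => ?_⟩
  have hball := closedBall_subset_affinoid hz hcN
  have cauchy := ((hf.hasExpansion (hcN.trans_le hz.2)).sub (hG z c hball)).norm_coeff_mul_pow_le
    (B := δ / 2 * ‖c ^ n‖) (fun ε hε => by
      obtain ⟨w, hw, rfl⟩ := exists_mem_sub_eq hball hε
      simpa only [Pi.sub_apply, translate_sub] using (hfg w hw).le) n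
  rw [map_sub, coeff_taylorSeries, PowerSeries.coeff_map, evalRegular_apply, norm_mul,
    mul_le_mul_iff_left₀ hcn] at cauchy
  exact cauchy.trans_lt (half_lt_self hδ)

end RigidAnalytic

section Periodic

variable {f : Omega F → CInf F}

variable (F) in
/-- The set `𝒪`, as a subspace of the space of functions on `Ω`. -/
def periodicRigidSubmodule : Submodule (CInf F) (Omega F → CInf F) where
  carrier := periodicRigid F
  add_mem' := by
    rintro f g ⟨hf, I, hI, hfI⟩ ⟨hg, J, hJ, hgJ⟩
    refine ⟨hf.add hg, I ⊓ J, fun h => (Ideal.mul_eq_bot.1 (le_bot_iff.1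
      (Ideal.mul_le_inf.trans h.le))).elim hI hJ, fun a ha z w hw => ?_⟩
    exact congrArg₂ (· + ·) (hfI a ha.1 z w hw) (hgJ a ha.2 z w hw)
  zero_mem' := ⟨zero_mem (rigidFunctions F), ⊤, top_ne_bot, fun _ _ _ _ _ => rfl⟩
  smul_mem' := by
    rintro b f ⟨hf, I, hI, hfI⟩
    exact ⟨(rigidFunctions F).smul_mem hf b, I, hI, fun a ha z w hw =>
      congrArg (b * ·) (hfI a ha z w hw)⟩

lemma hyperDeriv_mem_periodicRigid (hf : f ∈ periodicRigid F) (n : ℕ) :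
    hyperDeriv n f ∈ periodicRigid F := by
  obtain ⟨hf, I, hI, hfI⟩ := hf
  refine ⟨isRigidAnalytic_hyperDeriv hf n, I, hI, fun a ha z w hw => ?_⟩
  obtain ⟨c, hc, hcz⟩ := exists_norm_lt_CInf (F := F) (lt_min (imagAbs_pos z) (imagAbs_pos w))
  have shifted : HasExpansion c (translate f w) (taylorSeries f z) :=
    (hf.hasExpansion (hcz.trans_le (min_le_left _ _))).congr fun ε hε => by
      obtain ⟨u, rfl⟩ := exists_sub_eq (hε.trans_lt (hcz.trans_le (min_le_left _ _)))
      obtain ⟨v, hv⟩ := exists_sub_eq (hε.trans_lt (hcz.trans_le (min_le_right _ _)))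
      rw [translate_sub, ← hv, translate_sub]
      exact (hfI a ha u v (by linear_combination hv + hw)).symm
  rw [shifted.hyperDeriv_eq hc, coeff_taylorSeries]

end Periodic

section BoundedOnVerticalLines

variable {f : Omega F → CInf F}

variable (F) in
/-- The algebra of functions on `Ω` that are bounded on vertical lines. -/
def boundedFunctions : Subalgebra (CInf F) (Omega F → CInf F) where
  carrier := {f | BoundedOnVerticalLines f}
  add_mem' := by
    rintro f g ⟨N, B, hf⟩ ⟨N', B', hg⟩
    exact ⟨max N N', B + B', fun z hz => norm_add_le_of_le (hf z ((le_max_left _ _).trans hz))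
      (hg z ((le_max_right _ _).trans hz))⟩
  mul_mem' := by
    rintro f g ⟨N, B, hf⟩ ⟨N', B', hg⟩
    exact ⟨max N N', B * B', fun z hz => norm_mul_le_of_le (hf z ((le_max_left _ _).trans hz))
      (hg z ((le_max_right _ _).trans hz))⟩
  algebraMap_mem' a := ⟨0, ‖a‖, fun _ _ => le_rfl⟩

lemma boundedOnVerticalLines_kappa (γ : GL (Fin 2) (KInf F)) :
    BoundedOnVerticalLines (kappa γ) :=
  ⟨1, 1, fun z hz => (le_mul_of_one_le_right (norm_nonneg _) hz).trans
    (norm_kappa_mul_imagAbs_le γ z)⟩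

lemma BoundedOnVerticalLines.hyperDeriv (hfb : BoundedOnVerticalLines f) (hf : IsRigidAnalytic f)
    (n : ℕ) : BoundedOnVerticalLines (hyperDeriv n f) := by
  obtain ⟨N, B, hB⟩ := hfb
  refine ⟨max N 2, B, fun z hz => ?_⟩
  have one_lt : ‖(1 : CInf F)‖ < imagAbs z := by
    rw [norm_one]
    exact one_lt_two.trans_le ((le_max_right _ _).trans hz)
  have cauchy := (hf.hasExpansion one_lt).norm_coeff_mul_pow_le (B := B) (fun ε hε => by
    have hεz := hε.trans_lt one_lt
    obtain ⟨w, rfl⟩ := exists_sub_eq hεz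
    rw [translate_sub]
    exact hB w ((imagAbs_eq_of_norm_sub_lt hεz).symm ▸ (le_max_left _ _).trans hz)) n
  rwa [one_pow, mul_one, coeff_taylorSeries] at cauchy

end BoundedOnVerticalLines

/-! ### Hyperderivatives and the slash operators -/

open Finset (sum_congr)
open Finset.HasAntidiagonal (antidiagonal mem_antidiagonal)

section HyperDerivLinear

variable {f : Omega F → CInf F}

lemma hyperDeriv_smul (hf : IsRigidAnalytic f) (b : CInf F) (n : ℕ) :
    hyperDeriv n (b • f) = b • hyperDeriv n f := by
  funext z
  obtain ⟨c, hc, hcz⟩ := exists_norm_lt_CInf (F := F) (imagAbs_pos z)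
  have h : HasExpansion c (translate (b • f) z) (b • taylorSeries f z) :=
    ((hf.hasExpansion hcz).const_mul b).congr fun ε hε => by
      obtain ⟨w, rfl⟩ := exists_sub_eq (hε.trans_lt hcz)
      simp only [translate_sub, Pi.smul_apply, smul_eq_mul]
  rw [h.hyperDeriv_eq hc, PowerSeries.coeff_smul, coeff_taylorSeries, Pi.smul_apply, smul_eq_mul]

lemma hyperDeriv_sum {ι : Type*} {s : Finset ι} {g : ι → Omega F → CInf F}
    (hg : ∀ i ∈ s, IsRigidAnalytic (g i)) (n : ℕ) :
    hyperDeriv n (∑ i ∈ s, g i) = ∑ i ∈ s, hyperDeriv n (g i) := by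
  funext z
  obtain ⟨c, hc, hcz⟩ := exists_norm_lt_CInf (F := F) (imagAbs_pos z)
  have h : HasExpansion c (translate (∑ i ∈ s, g i) z) (∑ i ∈ s, taylorSeries (g i) z) :=
    (HasExpansion.sum fun i hi => (hg i hi).hasExpansion hcz).congr fun ε hε => by
      obtain ⟨w, rfl⟩ := exists_sub_eq (hε.trans_lt hcz)
      simp only [translate_sub, Finset.sum_apply]
  rw [h.hyperDeriv_eq hc, map_sum, Finset.sum_apply]
  exact sum_congr rfl fun i _ => coeff_taylorSeries _ _ _

end HyperDerivLinear

section SlashExpansion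

variable {f : Omega F → CInf F} {z : Omega F} {c : CInf F} {k m : ℤ} {γ : GL (Fin 2) (KInf F)}

/-- The function `v ↦ (det γ)^m (c z + d)^(-k) f(γ z + v det γ / (c z + d)^2)`: near `z`, the
function `f |_{k,m} γ` is `slashTranslate k m f γ z` in the coordinate `v` with
`v det γ / (c z + d)^2 = γ w - γ z`, up to a factor of automorphy. -/
def slashTranslate (k m : ℤ) (f : Omega F → CInf F) (γ : GL (Fin 2) (KInf F)) (z : Omega F)
    (v : CInf F) : CInf F :=
  detC γ ^ m * denom γ z ^ (-k) * translate f (moebius γ z) (detC γ / denom γ z ^ 2 * v)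

lemma slash_eq_zpow_mul_slashTranslate (k m : ℤ) (f : Omega F → CInf F)
    (γ : GL (Fin 2) (KInf F)) (z w : Omega F) : slash k m f γ w =
      (1 + kappa γ z * (w - z)) ^ (-k) *
        slashTranslate k m f γ z ((w - z) / (1 + kappa γ z * (w - z))) := by
  rw [slashTranslate, ← moebius_sub_moebius, translate_sub, slash, denom_eq_mul γ z w, mul_zpow]
  ring

lemma hasExpansion_slashTranslate (hf : IsRigidAnalytic f)
    (hc : ‖c‖ < imagAbs z) : HasExpansion c (slashTranslate k m f γ z)
      (PowerSeries.mk fun n => slash (k + 2 * n) (m + n) (hyperDeriv n f) γ z) := by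
  set b := detC γ / denom γ z ^ 2 with hb
  have radius : ‖b * c‖ < imagAbs (moebius γ z) := by
    refine lt_of_lt_of_le ?_ (imagAbs_moebius_ge γ z)
    rw [hb, norm_mul, norm_div, norm_pow, div_mul_eq_mul_div]
    have := norm_pos_iff.2 (detC_ne_zero γ)
    have := norm_pos_iff.2 (denom_ne_zero γ z)
    gcongr
  have expansion : HasExpansion c (slashTranslate k m f γ z) _ :=
    ((hf.hasExpansion radius).rescale le_rfl).const_mul (detC γ ^ m * denom γ z ^ (-k))
  convert expansion
  refine PowerSeries.ext fun n => ?_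
  have hden := denom_ne_zero γ z
  have exponent : -(k + 2 * (n : ℤ)) = -k - (2 * n : ℕ) := by push_cast; ring
  rw [PowerSeries.coeff_mk, PowerSeries.coeff_smul, PowerSeries.coeff_rescale, coeff_taylorSeries,
    slash, smul_eq_mul, zpow_add₀ (detC_ne_zero γ), exponent, zpow_sub₀ hden, zpow_natCast,
    zpow_natCast, hb, div_pow, ← pow_mul]
  ring

/-- Inverting `v = ε / (1 + κ ε)` gives `ε = v / (1 - κ v)` and `1 + κ ε = (1 - κ v)⁻¹`. -/
lemma exists_slashTranslate_eq (k m : ℤ) (f : Omega F → CInf F) (γ : GL (Fin 2) (KInf F))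
    {v : CInf F} (hv : ‖v‖ < imagAbs z) : ∃ w : Omega F, 1 + -kappa γ z * v ≠ 0 ∧
      (w : CInf F) - z = v / (1 + -kappa γ z * v) ∧
      kappa γ w = kappa γ z * (1 + -kappa γ z * v) ∧
      slashTranslate k m f γ z v = (1 + -kappa γ z * v) ^ (-k) * slash k m f γ w := by
  set u := 1 + -kappa γ z * v with hu
  have norm_u : ‖u‖ = 1 := norm_one_add_eq_one (by
    rw [neg_mul, norm_neg]
    exact norm_kappa_mul_lt_one γ z hv)
  have hu0 : u ≠ 0 := norm_ne_zero_iff.1 (norm_u ▸ one_ne_zero)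
  obtain ⟨w, hw⟩ := exists_sub_eq (z := z) (ε := v / u) (by rwa [norm_div, norm_u, div_one])
  have cocycle : 1 + kappa γ z * (w - z) = u⁻¹ := by
    rw [hw, ← mul_eq_one_iff_eq_inv₀ hu0, add_mul, ← mul_div_assoc, div_mul_cancel₀ _ hu0, hu]
    ring
  refine ⟨w, hu0, hw, by rw [kappa_eq_div γ z w, cocycle, div_inv_eq_mul], ?_⟩
  rw [slash_eq_zpow_mul_slashTranslate k m f γ z w, cocycle, hw, div_inv_eq_mul,
    div_mul_cancel₀ _ hu0, inv_zpow, mul_inv_cancel_left₀ (zpow_ne_zero _ hu0)]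

lemma hyperDeriv_neg_kappa_pow_mul_slash (hf : IsRigidAnalytic f) (k m : ℤ)
    (γ : GL (Fin 2) (KInf F)) (i n : ℕ) :
    hyperDeriv n ((-kappa γ) ^ i * slash k m f γ) =
      ∑ q ∈ antidiagonal n, Ring.choose (-k - i - q.1) q.2 •
        ((-kappa γ) ^ i * kappa γ ^ q.2 *
          slash (k + 2 * q.1) (m + q.1) (hyperDeriv q.1 f) γ) := by
  funext z
  obtain ⟨c, hc, hcz⟩ := exists_norm_lt_CInf (F := F) (imagAbs_pos z)
  have h : HasExpansion c (translate ((-kappa γ) ^ i * slash k m f γ) z) _ :=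
    (((hasExpansion_slashTranslate hf hcz).subst (norm_kappa_mul_lt_one γ z hcz)
      (-k - i)).const_mul ((-kappa γ z) ^ i)).congr fun ε hε => by
        obtain ⟨w, rfl⟩ := exists_sub_eq (hε.trans_lt hcz)
        have hw : 1 + kappa γ z * (w - z) ≠ 0 := one_add_kappa_mul_ne_zero γ z w
        rw [translate_sub, Pi.mul_apply, Pi.pow_apply, Pi.neg_apply, kappa_eq_div γ z w,
          slash_eq_zpow_mul_slashTranslate k m f γ z w, zpow_sub₀ hw, zpow_natCast, ← neg_div,
          div_pow]
        ring
  rw [h.hyperDeriv_eq hc]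
  rw [PowerSeries.coeff_smul, PowerSeries.coeff_mk, Finset.smul_sum, Finset.sum_apply]
  refine sum_congr rfl fun q _ => ?_
  rw [smul_comm, PowerSeries.coeff_mk, smul_eq_mul, ← mul_assoc]
  rfl

end SlashExpansion

section DerivPoly

variable {f : Omega F → CInf F} {k m : ℤ} {γ : GL (Fin 2) (KInf F)} {P : (Omega F → CInf F)[X]}

/-- The polynomial `∑ (-1)^s binom(i - k - r, s) 𝒟_r(f_i) X^(i+s)` (sum over `i` and `r + s = n`)
attached to `P = ∑ f_i X^i`: it is an associated polynomial of `𝒟_n f`, for the weight `k + 2n`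
and the type `m + n`, if `P` is one of `f` for the weight `k` and the type `m`. -/
def derivPoly (k : ℤ) (n : ℕ) (P : (Omega F → CInf F)[X]) : (Omega F → CInf F)[X] :=
  P.sum fun i g => ∑ q ∈ antidiagonal n,
    monomial (i + q.2) (((-1) ^ q.2 * Ring.choose (i - k - q.1) q.2 : ℤ) • hyperDeriv q.1 g)

lemma natDegree_derivPoly_le (k : ℤ) (n : ℕ) (P : (Omega F → CInf F)[X]) :
    (derivPoly k n P).natDegree ≤ P.natDegree + n :=
  natDegree_sum_le_of_forall_le _ _ fun _ hi => natDegree_sum_le_of_forall_le _ _ fun _ hq =>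
    (natDegree_monomial_le _).trans
      (add_le_add (le_natDegree_of_mem_supp _ hi) (by have := mem_antidiagonal.1 hq; lia))

lemma coeff_derivPoly_mem {n : ℕ} (S : ℕ → Submodule (CInf F) (Omega F → CInf F))
    (hS : ∀ i, ∀ q ∈ antidiagonal n, hyperDeriv q.1 (P.coeff i) ∈ S (i + q.2)) (j : ℕ) :
    (derivPoly k n P).coeff j ∈ S j := by
  rw [derivPoly, sum_def, finsetSum_coeff]
  refine sum_mem fun i _ => ?_
  rw [finsetSum_coeff]
  refine sum_mem fun q hq => ?_
  rw [coeff_monomial]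
  split_ifs with hj
  · exact zsmul_mem (hj ▸ hS i q hq) _
  · exact zero_mem _

theorem slash_hyperDeriv (hf : IsRigidAnalytic f) (hP : ∀ i, IsRigidAnalytic (P.coeff i))
    (h : slash k m f γ = P.eval (kappa γ)) (n : ℕ) :
    slash (k + 2 * n) (m + n) (hyperDeriv n f) γ = (derivPoly k n P).eval (kappa γ) := by
  funext z
  obtain ⟨c, hc, hcz⟩ := exists_norm_lt_CInf (F := F) (imagAbs_pos z)
  have hκc : ‖-kappa γ z * c‖ < 1 := by
    rw [neg_mul, norm_neg]
    exact norm_kappa_mul_lt_one γ z hcz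
  have expansion : HasExpansion c (slashTranslate k m f γ z) _ :=
    (HasExpansion.sum (s := P.support) fun i _ =>
      (((hP i).hasExpansion hcz).subst hκc (i - k)).const_mul (kappa γ z ^ i)).congr
        fun v hv => by
          obtain ⟨w, hκv, hw, kappa_w, slash_w⟩ :=
            exists_slashTranslate_eq k m f γ (hv.trans_lt hcz)
          rw [slash_w, h, eval_eq_sum, sum_def, Finset.sum_apply, Finset.sum_apply, Finset.mul_sum]
          refine sum_congr rfl fun i _ => ?_
          rw [← hw, translate_sub, Pi.mul_apply, Pi.pow_apply, kappa_w, mul_pow, sub_eq_neg_add,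
            zpow_add₀ hκv, zpow_natCast]
          ring
  have coeff_eq := congrArg (PowerSeries.coeff n)
    ((hasExpansion_slashTranslate hf hcz).unique hc expansion)
  rw [PowerSeries.coeff_mk] at coeff_eq
  rw [coeff_eq, derivPoly, sum_def, map_sum, eval_finsetSum, Finset.sum_apply]
  refine sum_congr rfl fun i _ => ?_
  rw [PowerSeries.coeff_smul, PowerSeries.coeff_mk, Finset.smul_sum, eval_finsetSum,
    Finset.sum_apply]
  refine sum_congr rfl fun q _ => ?_
  rw [eval_monomial, coeff_taylorSeries, smul_eq_mul, Pi.mul_apply, Pi.smul_apply, Pi.pow_apply,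
    zsmul_eq_mul, zsmul_eq_mul, neg_pow, pow_add]
  push_cast
  ring

end DerivPoly

section DoubleSlash

variable {P : (Omega F → CInf F)[X]}

/-- The slash operator, as a linear map. -/
def slashLinear (k m : ℤ) (γ : GL (Fin 2) (KInf F)) :
    (Omega F → CInf F) →ₗ[CInf F] Omega F → CInf F where
  toFun f := slash k m f γ
  map_add' _ _ := funext fun _ => mul_add _ _ _
  map_smul' _ _ := funext fun _ => mul_left_comm _ _ _

/-- The double-slash operator in terms of the associated polynomial: the linear map
`∑ f_i X^i ↦ ∑ (-c / (c z + d))^i (f_i |_{k-2i,m-i} γ)`. -/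
def doubleSlashPoly (k m : ℤ) (γ : GL (Fin 2) (KInf F)) :
    (Omega F → CInf F)[X] →ₗ[CInf F] Omega F → CInf F :=
  lsum fun i => LinearMap.mulLeft (CInf F) ((-kappa γ) ^ i) ∘ₗ slashLinear (k - 2 * i) (m - i) γ

lemma doubleSlashPoly_apply (k m : ℤ) (γ : GL (Fin 2) (KInf F)) (P : (Omega F → CInf F)[X]) :
    doubleSlashPoly k m γ P = P.sum fun i g => (-kappa γ) ^ i * slash (k - 2 * i) (m - i) g γ :=
  rfl

lemma doubleSlashPoly_monomial (k m : ℤ) (γ : GL (Fin 2) (KInf F)) (i : ℕ)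
    (g : Omega F → CInf F) : doubleSlashPoly k m γ (monomial i g) =
      (-kappa γ) ^ i * slash (k - 2 * i) (m - i) g γ :=
  sum_monomial_index _ _ (map_zero (LinearMap.mulLeft (CInf F) ((-kappa γ) ^ i) ∘ₗ
    slashLinear (k - 2 * i) (m - i) γ))

lemma doubleSlash_eq_doubleSlashPoly (Γ : Subgroup (GL (Fin 2) (RatFunc F))) (k m : ℤ)
    (f : Omega F → CInf F) (γ : GL (Fin 2) (KInf F)) :
    doubleSlash Γ k m f γ = doubleSlashPoly k m γ (assocPoly Γ k m f) := by
  rw [doubleSlashPoly_apply, sum_over_range]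
  · exact _root_.funext fun z => by rw [Finset.sum_apply]; rfl
  · intro i
    rw [← doubleSlashPoly_monomial, monomial_zero_right, map_zero]

lemma isRigidAnalytic_neg_kappa_pow_mul_slash {f : Omega F → CInf F} (hf : IsRigidAnalytic f)
    (k m : ℤ) (γ : GL (Fin 2) (KInf F)) (i : ℕ) :
    IsRigidAnalytic ((-kappa γ) ^ i * slash k m f γ) := by
  have neg_kappa_mem : -kappa γ ∈ rigidFunctions F :=
    (rigidFunctions F).neg_mem (isRigidAnalytic_kappa γ)
  exact IsRigidAnalytic.mul (pow_mem neg_kappa_mem i) (hf.slash k m γ)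

lemma isRigidAnalytic_doubleSlashPoly (hP : ∀ i, IsRigidAnalytic (P.coeff i)) (k m : ℤ)
    (γ : GL (Fin 2) (KInf F)) : IsRigidAnalytic (doubleSlashPoly k m γ P) :=
  sum_mem (S := rigidFunctions F) fun i _ => isRigidAnalytic_neg_kappa_pow_mul_slash (hP i) _ _ γ i

theorem doubleSlashPoly_derivPoly (hP : ∀ i, IsRigidAnalytic (P.coeff i)) (k m : ℤ) (n : ℕ)
    (γ : GL (Fin 2) (KInf F)) :
    doubleSlashPoly (k + 2 * n) (m + n) γ (derivPoly k n P) =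
      hyperDeriv n (doubleSlashPoly k m γ P) := by
  rw [doubleSlashPoly_apply k, sum_def, hyperDeriv_sum fun i _ =>
    isRigidAnalytic_neg_kappa_pow_mul_slash (hP i) _ _ γ i, derivPoly, sum_def, map_sum]
  refine sum_congr rfl fun i _ => ?_
  rw [hyperDeriv_neg_kappa_pow_mul_slash (hP i), map_sum]
  refine sum_congr rfl fun q hq => ?_
  have hn : (n : ℤ) = q.1 + q.2 := by exact_mod_cast (mem_antidiagonal.1 hq).symm
  have weight : k + 2 * n - 2 * ((i + q.2 : ℕ) : ℤ) = k - 2 * i + 2 * q.1 := by grind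
  have type : m + n - ((i + q.2 : ℕ) : ℤ) = m - i + q.1 := by grind
  have binomial_arg : -(k - 2 * i) - i - q.1 = (i : ℤ) - k - q.1 := by ring
  have sign : ((-1 : ℤ) ^ q.2) • (-kappa γ) ^ (i + q.2) = (-kappa γ) ^ i * kappa γ ^ q.2 := by
    rw [pow_add, mul_comm, zsmul_eq_mul, Int.cast_pow, Int.cast_neg, Int.cast_one, ← mul_assoc,
      ← mul_pow, neg_one_mul, neg_neg, mul_comm]
  rw [← smul_monomial, map_zsmul, doubleSlashPoly_monomial, weight, type, binomial_arg,
    mul_comm (_ ^ _ : ℤ), mul_smul, ← smul_mul_assoc ((-1) ^ q.2 : ℤ), sign]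

end DoubleSlash

section QuasiModular

variable {Γ : Subgroup (GL (Fin 2) (RatFunc F))} {k m : ℤ} {f : Omega F → CInf F}
  {P : (Omega F → CInf F)[X]}

lemma boundedOnVerticalLines_slash_hyperDeriv {γ : GL (Fin 2) (KInf F)} (hf : IsRigidAnalytic f)
    (hfb : BoundedOnVerticalLines (slash k m f γ)) (n : ℕ) :
    BoundedOnVerticalLines (slash (k + 2 * n) (m + n) (hyperDeriv n f) γ) := by
  have coeff_mem (i : ℕ) :
      (C (slash k m f γ)).coeff i ∈ rigidFunctions F ⊓ boundedFunctions F := by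
    rw [coeff_C]
    split_ifs
    exacts [⟨hf.slash k m γ, hfb⟩, zero_mem _]
  rw [slash_hyperDeriv hf (fun i => (coeff_mem i).1) eval_C.symm, eval_eq_sum]
  exact sum_mem (S := boundedFunctions F) fun j _ => mul_mem
    (coeff_derivPoly_mem (fun _ => (boundedFunctions F).toSubmodule)
      (fun i q _ => (coeff_mem i).2.hyperDeriv (coeff_mem i).1 q.1) j)
    (pow_mem (boundedOnVerticalLines_kappa γ) j)

lemma isAssocPoly_iff : IsAssocPoly Γ k m f P ↔ (∀ i, P.coeff i ∈ periodicRigid F) ∧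
    ∀ γ ∈ Γ, slash k m f (toInf F γ) = P.eval (kappa (toInf F γ)) := by
  refine and_congr_right fun _ => forall₂_congr fun γ _ => ?_
  rw [eval_eq_sum_range, funext_iff]
  simp only [Finset.sum_apply, Pi.mul_apply, Pi.pow_apply]

lemma IsAssocPoly.hyperDeriv (hP : IsAssocPoly Γ k m f P) (hf : IsRigidAnalytic f) (n : ℕ) :
    IsAssocPoly Γ (k + 2 * n) (m + n) (hyperDeriv n f) (derivPoly k n P) := by
  rw [isAssocPoly_iff] at hP ⊢
  exact ⟨coeff_derivPoly_mem (fun _ => periodicRigidSubmodule F) fun i q _ =>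
    hyperDeriv_mem_periodicRigid (hP.1 i) q.1, fun γ hγ =>
      slash_hyperDeriv hf (fun i => (hP.1 i).1) (hP.2 γ hγ) n⟩

theorem IsQuasiModularForm.hyperDeriv {ℓ : ℕ} (hf : IsQuasiModularForm Γ k m ℓ f) (n : ℕ) :
    IsQuasiModularForm Γ (k + 2 * n) (m + n) (ℓ + n) (hyperDeriv n f) := by
  obtain ⟨hf, P, hP, hℓ, hb⟩ := hf
  refine ⟨isRigidAnalytic_hyperDeriv hf n, derivPoly k n P, hP.hyperDeriv hf n,
    (natDegree_derivPoly_le k n P).trans (by gcongr), fun j γ => ?_⟩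
  refine coeff_derivPoly_mem (fun j => (boundedFunctions F).toSubmodule.comap
    (slashLinear (k + 2 * n - 2 * j) (m + n - j) (toInf F γ))) (fun i q hq => ?_) j
  have hn : (n : ℤ) = q.1 + q.2 := by exact_mod_cast (mem_antidiagonal.1 hq).symm
  have weight : k + 2 * n - 2 * ((i + q.2 : ℕ) : ℤ) = k - 2 * i + 2 * q.1 := by grind
  have type : m + n - ((i + q.2 : ℕ) : ℤ) = m - i + q.1 := by grind
  rw [weight, type]
  exact boundedOnVerticalLines_slash_hyperDeriv (hP.1 i).1 (hb i γ) q.1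

end QuasiModular

section Uniqueness

variable {Γ : Subgroup (GL (Fin 2) (RatFunc F))} {k m : ℤ} {f : Omega F → CInf F}
  {P Q : (Omega F → CInf F)[X]}

/-- The homomorphism `a ↦ [1, 0; a, 1]` from the additive group of a ring. -/
def lowerLeftHom (R : Type*) [Ring R] : AddChar R (GL (Fin 2) R) where
  toFun a := ⟨!![1, 0; a, 1], !![1, 0; -a, 1], by simp [Matrix.one_fin_two],
    by simp [Matrix.one_fin_two]⟩
  map_zero_eq_one' := by simp [Units.ext_iff, Matrix.one_fin_two]
  map_add_eq_mul' a b := by simp [Units.ext_iff]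

/-- The inclusion of `A` in `ℂ_∞`. -/
abbrev polyToCInf (F : Type*) [Field F] [Finite F] : F[X] →+* CInf F :=
  (algebraMap (KInf F) (CInf F)).comp
    ((algebraMap (RatFunc F) (KInf F)).comp (algebraMap F[X] (RatFunc F)))

lemma polyToCInf_injective : Function.Injective (polyToCInf F) :=
  (algebraMap (KInf F) (CInf F)).injective.comp
    ((algebraMap (RatFunc F) (KInf F)).injective.comp (RatFunc.algebraMap_injective F))

lemma infinite_image_kappa (hΓ : Γ.relIndex (glA F) ≠ 0) (z : Omega F) :
    ((fun γ => kappa (toInf F γ) z) '' (Γ : Set (GL (Fin 2) (RatFunc F)))).Infinite := by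
  let φ : Multiplicative F[X] →* GL (Fin 2) (RatFunc F) :=
    (Matrix.GeneralLinearGroup.map (algebraMap F[X] (RatFunc F))).comp
      (lowerLeftHom F[X]).toMonoidHom
  have range_le : φ.range ≤ glA F := by
    rw [glA, MonoidHom.range_comp]
    exact Subgroup.map_le_range _ _
  have finiteIndex : (Γ.comap φ).FiniteIndex := ⟨by
    rw [Subgroup.index_comap]
    exact mt (Subgroup.relIndex_eq_zero_of_le_right range_le) hΓ⟩
  have infinite : Infinite (Γ.comap φ) := by
    by_contra! h
    exact not_finite_iff_infinite.2 (inferInstance : Infinite (Multiplicative F[X]))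
      ((Subgroup.finite_iff_finite_and_finiteIndex (Γ.comap φ)).2 ⟨h, finiteIndex⟩)
  have denom_φ (a : F[X]) : denom (toInf F (φ (.ofAdd a))) z = polyToCInf F a * z + 1 := by
    have entry : algebraMap (KInf F) (CInf F) (toInf F (φ (.ofAdd a)) 1 1) = polyToCInf F 1 := rfl
    rw [denom, entry, map_one]
    rfl
  have kappa_φ (a : F[X]) : kappa (toInf F (φ (.ofAdd a))) z =
      polyToCInf F a / denom (toInf F (φ (.ofAdd a))) z := rfl
  have kappa_injective : Function.Injective fun a : Γ.comap φ => kappa (toInf F (φ a)) z := by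
    refine fun a b hab => Subtype.ext (polyToCInf_injective (F := F) ?_)
    have kappa_eq := (kappa_φ a.1.toAdd).symm.trans (hab.trans (kappa_φ b.1.toAdd))
    rw [div_eq_div_iff (denom_ne_zero _ z) (denom_ne_zero _ z), denom_φ, denom_φ] at kappa_eq
    change polyToCInf F a.1.toAdd = polyToCInf F b.1.toAdd
    linear_combination kappa_eq
  refine (Set.infinite_range_of_injective kappa_injective).mono ?_
  rintro _ ⟨a, rfl⟩
  exact ⟨φ a, a.2, rfl⟩

lemma IsAssocPoly.unique (hΓ : Γ.relIndex (glA F) ≠ 0) (hP : IsAssocPoly Γ k m f P)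
    (hQ : IsAssocPoly Γ k m f Q) : P = Q := by
  rw [isAssocPoly_iff] at hP hQ
  suffices h : ∀ z : Omega F, P.map (Pi.evalRingHom _ z) = Q.map (Pi.evalRingHom _ z) by
    ext i z
    simpa using congrArg (fun R => R.coeff i) (h z)
  refine fun z => eq_of_infinite_eval_eq _ _ ((infinite_image_kappa hΓ z).mono ?_)
  rintro _ ⟨γ, hγ, rfl⟩
  have eval_eq := congrFun ((hP.2 γ hγ).symm.trans (hQ.2 γ hγ)) z
  let evalAt : (Omega F → CInf F) →+* CInf F := Pi.evalRingHom _ z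
  exact (eval_map_apply evalAt _).trans (eval_eq.trans (eval_map_apply evalAt _).symm)

lemma IsAssocPoly.assocPoly_eq (hΓ : Γ.relIndex (glA F) ≠ 0) (hP : IsAssocPoly Γ k m f P) :
    assocPoly Γ k m f = P := by
  have exists_assocPoly : ∃ P, IsAssocPoly Γ k m f P := ⟨P, hP⟩
  rw [assocPoly, dif_pos exists_assocPoly]
  exact exists_assocPoly.choose_spec.unique hΓ hP

end Uniqueness

end DrinfeldHalfPlane

/-! ### Hecke operators -/

section Commensurator

open scoped Pointwise

lemma IsOrbitRepresentatives.finite {G : Type*} [Group G] {Γ : Subgroup G} {η : G} {R : Set G}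
    (hR : IsOrbitRepresentatives Γ η R) (h : (ConjAct.toConjAct η⁻¹ • Γ).relIndex Γ ≠ 0) :
    R.Finite := by
  set H := (ConjAct.toConjAct η⁻¹ • Γ).subgroupOf Γ with hH
  have : H.FiniteIndex := ⟨h⟩
  choose a ha b hb hab using fun r : R => DoubleCoset.mem_doubleCoset.1 (hR.1 r.2)
  refine Set.finite_coe_iff.1
    (Finite.of_injective (fun r : R => ((⟨b r, hb r⟩⁻¹ : Γ) : Γ ⧸ H)) fun r r' hrr' => ?_)
  have same_coset := QuotientGroup.eq.1 hrr'
  rw [hH, Subgroup.mem_subgroupOf, Subgroup.mem_pointwise_smul_iff_inv_smul_mem,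
    ConjAct.smul_def] at same_coset
  have conj_mem : η * (b r * (b r')⁻¹) * η⁻¹ ∈ Γ := by simpa using same_coset
  have hrr' : (r : G) = a r * (η * (b r * (b r')⁻¹) * η⁻¹) * (a r')⁻¹ * r' := by
    rw [hab r, hab r']
    group
  obtain ⟨x, -, hx⟩ := hR.2 r (hR.1 r.2)
  have r_eq := hx r ⟨r.2, 1, Γ.one_mem, (one_mul _).symm⟩
  have r'_eq := hx r' ⟨r'.2, _, Γ.mul_mem (Γ.mul_mem (ha r) conj_mem) (Γ.inv_mem (ha r')), hrr'⟩
  exact Subtype.ext (r_eq.trans r'_eq.symm)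

lemma finite_quotient_of_ne_bot {F : Type*} [Field F] [Finite F] {I : Ideal F[X]} (hI : I ≠ ⊥) :
    Finite (F[X] ⧸ I) := by
  obtain ⟨p, rfl⟩ := (IsPrincipalIdealRing.principal I).principal
  have := (AdjoinRoot.powerBasis (mt Ideal.span_singleton_eq_bot.2 hI)).finite
  exact Module.finite_of_finite F (M := AdjoinRoot p)

lemma relIndex_principalCongruence_ne_zero {F : Type*} [Field F] [Finite F] {I : Ideal F[X]}
    (hI : I ≠ ⊥) : (principalCongruence F I).relIndex (glA F) ≠ 0 := by
  have := finite_quotient_of_ne_bot hI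
  have index_ker : (Matrix.GeneralLinearGroup.map (n := Fin 2) (Ideal.Quotient.mk I)).ker.index ≠
      0 := by
    rw [Subgroup.index_ker]
    exact Nat.card_pos.ne'
  rw [principalCongruence, glA, MonoidHom.range_eq_map, Subgroup.relIndex_map_map, top_sup_eq,
    Subgroup.relIndex_top_right]
  exact ne_zero_of_dvd_ne_zero index_ker (Subgroup.index_dvd_of_le le_sup_left)

lemma exists_map_eq_smul {R S m n : Type*} [CommRing R] [CommRing S] [Algebra R S] (M : Submonoid R)
    [IsLocalization M S] [Finite m] [Finite n] (A : Matrix m n S) :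
    ∃ d ∈ M, ∃ B : Matrix m n R, B.map (algebraMap R S) = d • A := by
  obtain ⟨d, hd⟩ := IsLocalization.exist_integer_multiples_of_finite M fun p : m × n => A p.1 p.2
  choose b hb using hd
  exact ⟨d, d.2, Matrix.of fun i j => b (i, j), Matrix.ext fun i j => hb (i, j)⟩

lemma exists_eq_one_add_smul {R n : Type*} [CommRing R] [Fintype n] [DecidableEq n] {d : R}
    {γ : GL n R} (hγ : Matrix.GeneralLinearGroup.map (Ideal.Quotient.mk (Ideal.span {d})) γ = 1) :
    ∃ X : Matrix n n R, (γ : Matrix n n R) = 1 + d • X := by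
  have congruence (i j : n) : d ∣ γ i j - (1 : Matrix n n R) i j := by
    rw [← Ideal.mem_span_singleton, ← Ideal.Quotient.eq]
    have entry := congrArg (fun g : GL n (R ⧸ Ideal.span {d}) => g i j) hγ
    rw [Matrix.GeneralLinearGroup.coe_one, ← map_one (Ideal.Quotient.mk (Ideal.span {d})).mapMatrix]
      at entry
    exact entry
  choose x hx using congruence
  exact ⟨Matrix.of x, Matrix.ext fun i j => sub_eq_iff_eq_add'.1 (hx i j)⟩

variable {F : Type*} [Field F]

lemma mem_glA_of_map_eq {M : GL (Fin 2) (RatFunc F)} {Y : Matrix (Fin 2) (Fin 2) F[X]} {u : F[X]}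
    (hY : Y.map (algebraMap F[X] (RatFunc F)) = M) (hu : IsUnit u)
    (hdet : algebraMap F[X] (RatFunc F) u = M.det) : M ∈ glA F := by
  have det_eq : Y.det = u := RatFunc.algebraMap_injective F (by
    rw [hdet, Matrix.GeneralLinearGroup.val_det_apply, ← hY]
    exact RingHom.map_det _ _)
  exact ⟨Matrix.GeneralLinearGroup.mk'' Y (det_eq ▸ hu), Units.ext hY⟩

/-- If `a η` and `b η⁻¹` are integral, then so is `η⁻¹ (1 + b a X) η = 1 + (b η⁻¹) X (a η)` for
every integral `X`. -/
lemma exists_principalCongruence_le_conj (η : GL (Fin 2) (RatFunc F)) :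
    ∃ I : Ideal F[X], I ≠ ⊥ ∧ principalCongruence F I ≤ ConjAct.toConjAct η • glA F := by
  let φ : Matrix (Fin 2) (Fin 2) F[X] →ₐ[F[X]] Matrix (Fin 2) (Fin 2) (RatFunc F) :=
    (Algebra.ofId F[X] (RatFunc F)).mapMatrix
  obtain ⟨a, ha, A, hA : φ A = a • η.val⟩ := exists_map_eq_smul (nonZeroDivisors F[X]) η.val
  obtain ⟨b, hb, B, hB : φ B = b • η⁻¹.val⟩ := exists_map_eq_smul (nonZeroDivisors F[X]) η⁻¹.val
  refine ⟨Ideal.span {b * a}, mt Ideal.span_singleton_eq_bot.1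
    (nonZeroDivisors.ne_zero (mul_mem hb ha)), ?_⟩
  rintro _ ⟨γ, hγ, rfl⟩
  obtain ⟨X, hX⟩ := exists_eq_one_add_smul hγ
  rw [Subgroup.mem_pointwise_smul_iff_inv_smul_mem, ← ConjAct.toConjAct_inv,
    ConjAct.toConjAct_smul, inv_inv]
  refine mem_glA_of_map_eq (Y := 1 + B * X * A) ?_ γ.det.isUnit ?_
  · calc φ (1 + B * X * A)
        = 1 + (b • η⁻¹.val) * φ X * (a • η.val) := by
          rw [map_add, map_one, map_mul, map_mul, hA, hB]
      _ = η⁻¹.val * (1 + (b * a) • φ X) * η.val := by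
          rw [mul_add, add_mul, mul_one, Units.inv_mul, Matrix.mul_smul, Matrix.smul_mul,
            Matrix.smul_mul, Matrix.mul_smul, Matrix.smul_mul, smul_smul, mul_comm]
      _ = η⁻¹.val * φ γ.val * η.val := by rw [hX, map_add, map_one, map_smul]
  · rw [map_mul, map_mul, mul_right_comm, map_inv, inv_mul_cancel, one_mul,
      Matrix.GeneralLinearGroup.map_det]
    rfl

lemma mem_commensurator_glA [Finite F] (η : GL (Fin 2) (RatFunc F)) :
    η ∈ Subgroup.Commensurable.commensurator (glA F) := by
  have relIndex_conj (η : GL (Fin 2) (RatFunc F)) :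
      (ConjAct.toConjAct η • glA F).relIndex (glA F) ≠ 0 := by
    obtain ⟨I, hI, hle⟩ := exists_principalCongruence_le_conj η
    exact ne_zero_of_dvd_ne_zero (relIndex_principalCongruence_ne_zero hI)
      (Subgroup.relIndex_dvd_of_le_left _ hle)
  refine (Subgroup.Commensurable.commensurator_mem_iff _ _).2 ⟨relIndex_conj η, ?_⟩
  rw [← Subgroup.relIndex_pointwise_smul (ConjAct.toConjAct η)⁻¹, inv_smul_smul,
    ← ConjAct.toConjAct_inv]
  exact relIndex_conj η⁻¹

lemma IsOrbitRepresentatives.finite_of_commensurable [Finite F]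
    {Γ : Subgroup (GL (Fin 2) (RatFunc F))} (hΓ : Subgroup.Commensurable Γ (glA F))
    {η : GL (Fin 2) (RatFunc F)} {R : Set (GL (Fin 2) (RatFunc F))}
    (hR : IsOrbitRepresentatives Γ η R) : R.Finite := by
  have mem_commensurator := mem_commensurator_glA η⁻¹
  rw [← hΓ.eq, Subgroup.Commensurable.commensurator_mem_iff] at mem_commensurator
  exact hR.finite mem_commensurator.1

end Commensurator

section Hecke

variable {F : Type*} [Field F] [Finite F] {Γ : Subgroup (GL (Fin 2) (RatFunc F))} {k m : ℤ}
  {f : Omega F → CInf F} {P : (Omega F → CInf F)[X]} {R : Set (GL (Fin 2) (RatFunc F))}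

lemma IsAssocPoly.heckeOp_eq (hP : IsAssocPoly Γ k m f P) (hΓ : Γ.relIndex (glA F) ≠ 0)
    (η : GL (Fin 2) (RatFunc F)) (hR : R.Finite) : heckeOp Γ η R k m f =
      detC (toInf F η) ^ (k - m) • ∑ γ ∈ hR.toFinset, doubleSlashPoly k m (toInf F γ) P := by
  simp only [heckeOp, finsum_mem_eq_finite_toFinset_sum _ hR, doubleSlash_eq_doubleSlashPoly,
    hP.assocPoly_eq hΓ]

lemma isRigidAnalytic_heckeOp (hP : IsAssocPoly Γ k m f P)
    (hΓ : Γ.relIndex (glA F) ≠ 0) (η : GL (Fin 2) (RatFunc F)) (hR : R.Finite) :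
    IsRigidAnalytic (heckeOp Γ η R k m f) := by
  rw [hP.heckeOp_eq hΓ η hR]
  exact (rigidFunctions F).smul_mem (sum_mem fun γ _ =>
    isRigidAnalytic_doubleSlashPoly (fun i => (hP.1 i).1) k m (toInf F γ)) _

theorem heckeOp_hyperDeriv (hP : IsAssocPoly Γ k m f P) (hf : IsRigidAnalytic f)
    (hΓ : Γ.relIndex (glA F) ≠ 0) (η : GL (Fin 2) (RatFunc F)) (hR : R.Finite) (n : ℕ) :
    heckeOp Γ η R (k + 2 * n) (m + n) (hyperDeriv n f) =
      detC (toInf F η) ^ n • hyperDeriv n (heckeOp Γ η R k m f) := by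
  have coeff_rigid (i : ℕ) : IsRigidAnalytic (P.coeff i) := (hP.1 i).1
  have term_rigid (γ : GL (Fin 2) (KInf F)) : IsRigidAnalytic (doubleSlashPoly k m γ P) :=
    isRigidAnalytic_doubleSlashPoly coeff_rigid k m γ
  have sum_rigid : IsRigidAnalytic (∑ γ ∈ hR.toFinset, doubleSlashPoly k m (toInf F γ) P) :=
    sum_mem (S := rigidFunctions F) fun γ _ => term_rigid (toInf F γ)
  have exponent : k + 2 * n - (m + n) = n + (k - m) := by ring
  rw [(hP.hyperDeriv hf n).heckeOp_eq hΓ η hR, hP.heckeOp_eq hΓ η hR, hyperDeriv_smul sum_rigid,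
    hyperDeriv_sum fun γ _ => term_rigid (toInf F γ), smul_smul, exponent,
    zpow_add₀ (detC_ne_zero _), zpow_natCast]
  simp only [doubleSlashPoly_derivPoly coeff_rigid]

end Hecke

end DrinfeldQM

end

open DrinfeldQM

theorem proposition5p6_general {F : Type*} [Field F] [Finite F]
    (Γ : Subgroup (GL (Fin 2) (RatFunc F))) (hΓ : Subgroup.Commensurable Γ (glA F))
    (k m : ℤ) (ℓ : ℕ) (f : Omega F → CInf F) (hf : IsQuasiModularForm Γ k m ℓ f)
    (η : GL (Fin 2) (RatFunc F)) (R : Set (GL (Fin 2) (RatFunc F)))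
    (hR : IsOrbitRepresentatives Γ η R) (n : ℕ) :
    IsRigidAnalytic (heckeOp Γ η R k m f) ∧
    IsQuasiModularForm Γ (k + 2 * n) (m + n) (ℓ + n) (hyperDeriv n f) ∧
    heckeOp Γ η R (k + 2 * n) (m + n) (hyperDeriv n f) =
      detC (toInf F η) ^ n • hyperDeriv n (heckeOp Γ η R k m f) ∧
    ∀ lam : CInf F, IsEigenform Γ η R k m lam f → hyperDeriv n f ≠ 0 →
      IsEigenform Γ η R (k + 2 * n) (m + n) (detC (toInf F η) ^ n * lam) (hyperDeriv n f) := by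
  have R_finite : R.Finite := hR.finite_of_commensurable hΓ
  obtain ⟨f_rigid, P, hP, -, -⟩ := id hf
  have quasiModular := hf.hyperDeriv n
  have commute := heckeOp_hyperDeriv hP f_rigid hΓ.1 η R_finite n
  refine ⟨isRigidAnalytic_heckeOp hP hΓ.1 η R_finite, quasiModular, commute,
    fun lam eigenform ne_zero => ⟨⟨_, quasiModular⟩, ne_zero, ?_⟩⟩
  rw [commute, eigenform.2.2, hyperDeriv_smul f_rigid, mul_smul]

theorem proposition5p6 {F : Type*} [Field F] [Finite F]
    (Γ : Subgroup (GL (Fin 2) (RatFunc F))) (hΓ : IsArithmeticCongruence Γ)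
    (k ℓ : ℕ) (m : ℤ) (f : Omega F → CInf F) (hf : IsQuasiModularForm Γ k m ℓ f)
    (η : GL (Fin 2) (RatFunc F)) (R : Set (GL (Fin 2) (RatFunc F)))
    (hR : IsOrbitRepresentatives Γ η R) (n : ℕ) :
    IsRigidAnalytic (heckeOp Γ η R k m f) ∧
    IsQuasiModularForm Γ (k + 2 * n) (m + n) (ℓ + n) (hyperDeriv n f) ∧
    heckeOp Γ η R (k + 2 * n) (m + n) (hyperDeriv n f) =
      detC (toInf F η) ^ n • hyperDeriv n (heckeOp Γ η R k m f) ∧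
    ∀ lam : CInf F, IsEigenform Γ η R k m lam f → hyperDeriv n f ≠ 0 →
      IsEigenform Γ η R (k + 2 * n) (m + n) (detC (toInf F η) ^ n * lam) (hyperDeriv n f) :=
  proposition5p6_general Γ hΓ.1 k m ℓ f hf η R hR n
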